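/- **Setting.** Remote radio heads (RRHs) with $M\ge 1$ antennas each form a homogeneous Poisson point process $\Phi=\{x_k\}$ of density $\lambda>0$ in a measurable region $\mathcal D$ of the plane (a disc of radius $R$ centred at the origin, or the whole plane); independently, each RRH is a downlink (DL) RRH with probability $p\in[0,1]$, and $\Phi_{\mathsf d}$ is the set of DL RRHs. The user is at the origin. The DL channel vectors $h_k\sim\mathcal{CN}(0,I_M)$ of the RRHs are i.i.d., the residual loop interference channel is $h_{\mathsf{LI}}\sim\mathcal{CN}(0,\sigma)$ with $\sigma>0$, and locations, marks, DL channels and $h_{\mathsf{LI}}$ are independent. The path loss is $\ell(x)=1/(\epsilon+\|x\|^{\alpha})$ with $\alpha>2$ and $\epsilon>0$, or $\epsilon=0$ (standard singular path loss). When all DL RRHs in the ball $b(o,R)$ transmit to the user (all-RRH association, ARA) with power $P_b>0$ and maximum ratio transmission (MRT) beamformers $w_k=h_k/\|h_k\|$, the user, which transmits with power $P_u>0$, has $$\mathsf{SINR}_{\mathsf d}=\frac{\sum_{x_k\in\Phi_{\mathsf d}\cap b(o,R)}P_b\,\ell(x_k)\,|h_k^\dagger w_k|^2}{P_u|h_{\mathsf{LI}}|^2+1},\qquad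 \mathcal R_{\mathsf d}(R)=\mathbb E[\ln(1+\mathsf{SINR}_{\mathsf d})],$$ and $\mathcal R_{\mathsf d}(\infty)$ denotes the average rate when all DL RRHs of $\Phi_{\mathsf d}$ transmit. **Proposition.** For every $\epsilon\ge 0$ put $$\bar{\mathcal R}_{\mathsf d}(\epsilon)=\int_0^\infty\Bigl(1-\exp\Bigl(-2\pi p\lambda\int_0^\infty\Bigl(1-\Bigl(1+\frac{zP_b}{\epsilon+r^\alpha}\Bigr)^{-M}\Bigr)\,r\,dr\Bigr)\Bigr)\frac{e^{-z}}{z(1+P_u\sigma z)}\,dz .$$ All these integrals converge, and the average DL rate satisfies $\mathcal R_{\mathsf d}(R)\le\bar{\mathcal R}_{\mathsf d}(\epsilon)$ for every $R>0$ (with $\ln(1+\mathsf{SINR}_{\mathsf d})$ integrable). If $\mathcal D$ is the whole plane, then the received power from all DL RRHs is almost surely finite, $\ln(1+\mathsf{SINR}_{\mathsf d})$ is integrable also for $R=\infty$, and $\lim_{R\to\infty}\mathcal R_{\mathsf d}(R)=\mathcal R_{\mathsf d}(\infty)=\bar{\mathcal R}_{\mathsf d}(\epsilon)$. Moreover, for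 the singular path loss, with $\delta=2/\alpha$ and $\Gamma_\alpha=\frac{\delta\pi p\lambda}{\Gamma(M)}\Gamma(M+\delta)\Gamma(-\delta)$, the series $$\bar{\mathcal R}_{\mathsf d}=-\sum_{k=1}^\infty\frac{(\Gamma_\alpha P_b^\delta)^k}{\Gamma(k+1)}\,G_{21}^{12}\Bigl(P_u\sigma\,\Big|\,{1-\delta k,\,0\atop 0}\Bigr)$$ (where $G$ is Meijer's G-function) converges absolutely, $\bar{\mathcal R}_{\mathsf d}=\lim_{\epsilon\to0^+}\bar{\mathcal R}_{\mathsf d}(\epsilon)=\bar{\mathcal R}_{\mathsf d}(0)$, and for $\epsilon=0$ the average DL rate satisfies $\mathcal R_{\mathsf d}(R)\le\bar{\mathcal R}_{\mathsf d}$ for every $R>0$, with $\mathcal R_{\mathsf d}(R)\to\bar{\mathcal R}_{\mathsf d}$ as $R\to\infty$ if $\mathcal D$ is the whole plane. -/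

import Mathlib

open MeasureTheory ProbabilityTheory Filter Topology
open scoped NNReal ENNReal

noncomputable section

namespace CRAN

/-- The Euclidean plane in which the remote radio heads (RRHs) are located. -/
abbrev Plane : Type := EuclideanSpace ℝ (Fin 2)

/-! ### Meijer's G-function -/

/-- The vertical line `Re s = γ` separates the poles of `Γ (b j - s)`, `j < m`, which lie to its
right, from the poles of `Γ (1 - a j + s)`, `j < n`, which lie to its left. -/
def MeijerSeparates (m n : ℕ) {p q : ℕ} (a : Fin p → ℂ) (b : Fin q → ℂ) (γ : ℝ) : Prop :=
  (∀ j : Fin q, (j : ℕ) < m → γ < (b j).re) ∧ (∀ j : Fin p, (j : ℕ) < n → (a j).re - 1 < γ)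

/-- The integrand
`∏_{j ≤ m} Γ(b_j - s) ∏_{j ≤ n} Γ(1 - a_j + s) / (∏_{j > m} Γ(1 - b_j + s) ∏_{j > n} Γ(a_j - s)) x^s`
of the Mellin-Barnes integral. (`Complex.Gamma` vanishes at the poles of `Γ`, so the inverses below
are the entire function `1 / Γ`.) -/
def meijerIntegrand (m n : ℕ) {p q : ℕ} (a : Fin p → ℂ) (b : Fin q → ℂ) (x s : ℂ) : ℂ :=
  (∏ j : Fin q, if (j : ℕ) < m then Complex.Gamma (b j - s) else (Complex.Gamma (1 - b j + s))⁻¹) *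
  (∏ j : Fin p, if (j : ℕ) < n then Complex.Gamma (1 - a j + s) else (Complex.Gamma (a j - s))⁻¹) *
  x ^ s

open Classical in
/-- Meijer's function `G_{p q}^{m n} (x | a_1 … a_p ; b_1 … b_q)`, as the Mellin-Barnes integral
`(1 / 2πi) ∫_L … x^s ds` over a vertical line `L` that separates the two families of poles, for the
parameters for which there is such a line. -/
def meijerG (m n : ℕ) {p q : ℕ} (a : Fin p → ℂ) (b : Fin q → ℂ) (x : ℂ) : ℂ :=
  if hγ : ∃ γ : ℝ, MeijerSeparates m n a b γ then
    (1 / (2 * Real.pi) : ℂ) *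
      ∫ t : ℝ, meijerIntegrand m n a b x ((hγ.choose : ℂ) + (t : ℂ) * Complex.I)
  else 0

/-! ### Complex Gaussian channels -/

/-- The circularly symmetric complex Gaussian law `CN(0, v)`: independent real and imaginary parts,
each `N(0, v / 2)`. -/
def complexGaussian (v : ℝ≥0) : Measure ℂ :=
  ((gaussianReal 0 (v / 2)).prod (gaussianReal 0 (v / 2))).map
    (fun z : ℝ × ℝ => (⟨z.1, z.2⟩ : ℂ))

/-- The law `CN(0, I_M)` on `ℂ^M`. -/
def complexGaussianVector (M : ℕ) : Measure (EuclideanSpace ℂ (Fin M)) :=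
  (Measure.pi (fun _ : Fin M => complexGaussian 1)).map
    (fun v => (WithLp.toLp 2 v : EuclideanSpace ℂ (Fin M)))

/-! ### Poisson point processes -/

/-- The number of points in `A` of the point configuration `x_0, x_1, …, x_{N-1}`
(`x_0, x_1, …` if `N = ∞`). -/
def pointCount (N : ℕ∞) (x : ℕ → Plane) (A : Set Plane) : ℕ∞ :=
  Set.encard {k : ℕ | (k : ℕ∞) < N ∧ x k ∈ A}

/-- The random points `x_k`, `k < N`, form a Poisson point process with intensity measure `Λ`:
the number of points in a measurable set of finite `Λ`-measure is Poisson distributed with mean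
`Λ A`, and the numbers of points in disjoint measurable sets are independent. -/
structure IsPoissonProcess {Ω : Type*} [MeasurableSpace Ω] (P : Measure Ω)
    (N : Ω → ℕ∞) (x : ℕ → Ω → Plane) (Λ : Measure Plane) : Prop where
  measurable_number : Measurable N
  measurable_point : ∀ k, Measurable (x k)
  count_law : ∀ A : Set Plane, MeasurableSet A → Λ A ≠ ∞ → ∀ n : ℕ,
    P {ω | pointCount (N ω) (fun k => x k ω) A = n} =
      ENNReal.ofReal (Real.exp (-(Λ A).toReal) * (Λ A).toReal ^ n / n.factorial)
  count_indep : ∀ (n : ℕ) (A : Fin n → Set Plane), (∀ i, MeasurableSet (A i)) →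
    Pairwise (fun i j => Disjoint (A i) (A j)) →
    iIndepFun (fun i ω => pointCount (N ω) (fun k => x k ω) (A i)) P

/-! ### The network -/

/-- The random quantities that govern the downlink: the RRHs form a homogeneous Poisson point
process `Φ = {x_k}` of density `lam` in the region `D` of the plane, the `k`-th RRH is a downlink
RRH when its Bernoulli(`p`) mark is `true` (an uplink RRH otherwise), it has the channel vector
`h_k ~ CN(0, I_M)` to the user at the origin, and the residual loop interference channel of
the user is `hLI ~ CN(0, σ)`. Locations, marks, channels and loop interference are independent. -/
structure Network {Ω : Type*} [MeasurableSpace Ω] (P : Measure Ω) (M : ℕ) (lam p σ : ℝ)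
    (D : Set Plane) where
  /-- number of RRHs -/
  N : Ω → ℕ∞
  /-- locations of the RRHs -/
  x : ℕ → Ω → Plane
  /-- downlink marks -/
  B : ℕ → Ω → Bool
  /-- downlink channel vectors -/
  h : ℕ → Ω → EuclideanSpace ℂ (Fin M)
  /-- loop interference channel -/
  hLI : Ω → ℂ
  poisson : IsPoissonProcess P N x (ENNReal.ofReal lam • (volume.restrict D))
  measurable_B : ∀ k, Measurable (B k)
  B_law : ∀ k, P {ω | B k ω = true} = ENNReal.ofReal p
  B_indep : iIndepFun B P
  measurable_h : ∀ k, Measurable (h k)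
  h_law : ∀ k, P.map (h k) = complexGaussianVector M
  h_indep : iIndepFun h P
  measurable_hLI : Measurable hLI
  hLI_law : P.map hLI = complexGaussian σ.toNNReal
  indep_points : IndepFun (fun ω => (N ω, fun k => x k ω))
    (fun ω => ((fun k => B k ω), (fun k => h k ω), hLI ω)) P
  indep_marks : IndepFun (fun ω k => B k ω) (fun ω => ((fun k => h k ω), hLI ω)) P
  indep_channels : IndepFun (fun ω k => h k ω) hLI P

/-- The path loss `1 / (ε + ‖x‖ ^ α)` between `x` and the user at the origin (`ε = 0`: the standard
singular path loss). -/
def pathLoss (ε α : ℝ) (x : Plane) : ℝ := 1 / (ε + ‖x‖ ^ α)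

/-- The maximum ratio transmission (MRT) beamforming vector `h / ‖h‖`. -/
def mrt {M : ℕ} (h : EuclideanSpace ℂ (Fin M)) : EuclideanSpace ℂ (Fin M) :=
  ((‖h‖ : ℂ)⁻¹) • h

namespace Network

variable {Ω : Type*} [MeasurableSpace Ω] {P : Measure Ω} {M : ℕ} {lam p σ : ℝ} {D : Set Plane}

open Classical in
/-- The power `P_b ℓ(x_k) |h_k† w_k|²` received from the `k`-th RRH with MRT, if this is a downlink
RRH located in the set `A`; `0` otherwise. -/
def receivedPower (S : Network P M lam p σ D) (ε α Pb : ℝ) (A : Set Plane) (k : ℕ) (ω : Ω) : ℝ :=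
  if (k : ℕ∞) < S.N ω ∧ S.B k ω = true ∧ S.x k ω ∈ A then
    Pb * pathLoss ε α (S.x k ω) * ‖inner ℂ (S.h k ω) (mrt (S.h k ω))‖ ^ 2
  else 0

/-- The downlink SINR when all downlink RRHs in `A` transmit to the user. -/
def sinr (S : Network P M lam p σ D) (ε α Pb Pu : ℝ) (A : Set Plane) (ω : Ω) : ℝ :=
  (∑' k, S.receivedPower ε α Pb A k ω) / (Pu * ‖S.hLI ω‖ ^ 2 + 1)

/-- The average downlink rate `E[ln (1 + SINR)]` when all downlink RRHs in `A` transmit. -/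
def avgRate (S : Network P M lam p σ D) (ε α Pb Pu : ℝ) (A : Set Plane) : ℝ :=
  ∫ ω, Real.log (1 + S.sinr ε α Pb Pu A ω) ∂P

end Network

/-! ### The bounds -/

/-- The integrand, in polar coordinates, of the exponent of the Laplace transform of the received
power. -/
def exponentIntegrand (M : ℕ) (ε α Pb z r : ℝ) : ℝ :=
  (1 - ((1 + z * Pb / (ε + r ^ α)) ^ M)⁻¹) * r

/-- The integrand of the bound on the average downlink rate. -/
def boundIntegrand (M : ℕ) (lam p σ ε α Pb Pu z : ℝ) : ℝ :=
  (1 - Real.exp (-(2 * Real.pi * p * lam * ∫ r in Set.Ioi (0 : ℝ), exponentIntegrand M ε α Pb z r)))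
    * (Real.exp (-z) / (z * (1 + Pu * σ * z)))

/-- The bound on the average downlink rate. -/
def rateBound (M : ℕ) (lam p σ ε α Pb Pu : ℝ) : ℝ :=
  ∫ z in Set.Ioi (0 : ℝ), boundIntegrand M lam p σ ε α Pb Pu z

/-- `δ π p λ Γ(M + δ) Γ(-δ) / Γ(M)`. -/
def gammaConst (M : ℕ) (lam p δ : ℝ) : ℝ :=
  δ * Real.pi * p * lam / Real.Gamma M * Real.Gamma (M + δ) * Real.Gamma (-δ)

/-- The `k`-th term `-(Γ_α P_b^δ)^k / Γ(k + 1) · G_{2 1}^{1 2} (P_u σ | 1 - δ k, 0 ; 0)` of the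
series for the singular path loss. -/
def seriesTerm (M : ℕ) (lam p σ δ Pb Pu : ℝ) (k : ℕ) : ℂ :=
  -((((gammaConst M lam p δ * Pb ^ δ) ^ k / Real.Gamma (k + 1) : ℝ) : ℂ) *
    meijerG 1 2 ![1 - (δ : ℂ) * k, 0] ![0] ((Pu * σ : ℝ) : ℂ))

end CRAN

end

/-! Write X for the received power and V for the interference power. Frullani's integral gives ln(1
+ X/(V+1)) = ∫ e^{-z}/z · e^{-zV} (1 - e^{-zX}) dz, so by Tonelli the average rate depends only on
Laplace transforms (`lintegral_logKernel`). The one of V is 1/(1 + P_u σ z). MRT turns each gain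
into ‖h‖², with transform (1+t)^{-M}. Averaging over marks and channels given the locations leaves a
product over the points, and the Laplace functional of the Poisson process
(`IsPoissonProcess.laplace_functional`) turns it into the exponential of -pλ ∫ (1 - (1 +
zP_bℓ)^{-M}) (`Network.laplace_totalPower`).

The exponent grows with the region, and on the whole plane polar coordinates give exactly
`boundIntegrand`. Hence there is equality on the plane and an upper bound elsewhere. The computation
takes place in [0, ∞] with e^{-∞} = 0, so nothing has to be finite beforehand; finiteness of the
bound then forces the power to be almost surely finite, because the kernel with X = ∞ has infinite
integral. Dominated convergence gives the limit R → ∞, and also ε → 0, where the singular case is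
the dominating function.

For ε = 0 a Beta integral evaluates the exponent as a multiple of z^δ (`exponent_zero_eq`).
Expanding the exponential and integrating termwise (`hasSum_stieltjesGamma`) leaves integrals of
z^{δk-1} e^{-z}/(1 + P_u σ z), which Mellin inversion identifies with the Meijer functions
(`meijerG_eq`). -/

namespace CRAN

/-! ### The exponential `exp (-x)` on `[0, ∞]` -/

/-- `exp (-x)` for `x ∈ [0, ∞]`, with `exp (-∞) = 0`. -/
noncomputable def expNeg (x : ℝ≥0∞) : ℝ≥0∞ := EReal.exp (-(x : EReal))

lemma expNeg_ofReal {x : ℝ} (hx : 0 ≤ x) :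
    expNeg (ENNReal.ofReal x) = ENNReal.ofReal (Real.exp (-x)) := by
  rw [expNeg, EReal.coe_ennreal_ofReal, max_eq_left hx, ← EReal.coe_neg, EReal.exp_coe]

@[simp] lemma expNeg_top : expNeg ∞ = 0 := by simp [expNeg]

@[simp] lemma expNeg_zero : expNeg 0 = 1 := by simp [expNeg]

lemma expNeg_add (x y : ℝ≥0∞) : expNeg (x + y) = expNeg x * expNeg y := by
  simp only [expNeg, EReal.exp_neg, EReal.coe_ennreal_add, EReal.exp_add]
  refine ENNReal.mul_inv (Or.inl ?_) (Or.inr ?_) <;> simp [EReal.exp_eq_zero_iff]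

lemma expNeg_antitone : Antitone expNeg := fun x y h =>
  EReal.exp_monotone (EReal.neg_le_neg_iff.2 (by exact_mod_cast h))

lemma expNeg_le_one (x : ℝ≥0∞) : expNeg x ≤ 1 := by
  simpa using expNeg_antitone zero_le

lemma expNeg_ne_top (x : ℝ≥0∞) : expNeg x ≠ ∞ :=
  ((expNeg_le_one x).trans_lt ENNReal.one_lt_top).ne

lemma continuous_expNeg : Continuous expNeg :=
  EReal.expHomeomorph.continuous.comp (continuous_neg.comp continuous_coe_ennreal_ereal)

lemma measurable_expNeg : Measurable expNeg := continuous_expNeg.measurable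

lemma expNeg_sum {ι : Type*} (s : Finset ι) (f : ι → ℝ≥0∞) :
    expNeg (∑ i ∈ s, f i) = ∏ i ∈ s, expNeg (f i) := by
  classical
  induction s using Finset.induction_on with
  | empty => simp
  | insert a s ha ih => rw [Finset.sum_insert ha, Finset.prod_insert ha, expNeg_add, ih]

lemma expNeg_natCast_mul (n : ℕ) (c : ℝ≥0∞) : expNeg (n * c) = expNeg c ^ n := by
  have := expNeg_sum (Finset.range n) (fun _ => c)
  simpa using this

lemma tendsto_expNeg_sum (f : ℕ → ℝ≥0∞) :
    Tendsto (fun n => ∏ i ∈ Finset.range n, expNeg (f i)) atTop (𝓝 (expNeg (∑' i, f i))) := by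
  simp_rw [← expNeg_sum]
  exact (continuous_expNeg.tendsto _).comp (ENNReal.tendsto_nat_tsum f)

lemma one_sub_expNeg_ofReal {x : ℝ} (hx : 0 ≤ x) :
    1 - expNeg (ENNReal.ofReal x) = ENNReal.ofReal (1 - Real.exp (-x)) := by
  rw [expNeg_ofReal hx, ENNReal.ofReal_sub _ (Real.exp_nonneg _), ENNReal.ofReal_one]

/-! ### The Laplace functional of a Poisson point process -/

section Poisson

variable {Ω : Type*} [MeasurableSpace Ω] {P : Measure Ω}
  {N : Ω → ℕ∞} {x : ℕ → Ω → Plane} {Λ : Measure Plane}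

lemma pointCount_eq_tsum (N : ℕ∞) (x : ℕ → Plane) (A : Set Plane) :
    (pointCount N x A : ℝ≥0∞) = ∑' k, {k : ℕ | (k : ℕ∞) < N ∧ x k ∈ A}.indicator 1 k := by
  rw [pointCount, ← ENNReal.tsum_set_one, tsum_subtype _ (fun _ => (1 : ℝ≥0∞))]
  rfl

-- Grouping the points by the value of g reduces the sum to counts on disjoint level sets, where the
-- Poisson axioms apply. The value 0 is dropped because its level set may have infinite measure.
open Classical in
lemma tsum_simpleFunc (N : ℕ∞) (x : ℕ → Plane) (g : SimpleFunc Plane ℝ≥0∞) :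
    ∑' k : ℕ, (if (k : ℕ∞) < N then g (x k) else 0) =
      ∑ c ∈ g.range with c ≠ 0, (pointCount N x (g ⁻¹' {c}) : ℝ≥0∞) * c := by
  simp_rw [pointCount_eq_tsum, ← ENNReal.tsum_mul_right]
  rw [← Summable.tsum_finsetSum (fun _ _ => ENNReal.summable)]
  congr 1 with k
  by_cases hk : (k : ℕ∞) < N
  · simp only [hk, if_true, true_and, Set.indicator_apply, Set.mem_ofPred_eq, Set.mem_preimage,
      Set.mem_singleton_iff, ite_mul, Pi.one_apply, one_mul, zero_mul]
    rw [Finset.sum_ite_eq]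
    by_cases h0 : g (x k) = 0 <;> simp [h0]
  · simp [hk]

lemma IsPoissonProcess.measurable_tsum (h : IsPoissonProcess P N x Λ) {f : Plane → ℝ≥0∞}
    (hf : Measurable f) :
    Measurable fun ω => ∑' k : ℕ, (if (k : ℕ∞) < N ω then f (x k ω) else 0) := by
  refine Measurable.tsum fun k => Measurable.ite ?_ (hf.comp (h.measurable_point k))
    measurable_const
  exact h.measurable_number (MeasurableSet.of_discrete (s := Set.Ioi (k : ℕ∞)))

lemma IsPoissonProcess.measurable_pointCount (h : IsPoissonProcess P N x Λ) {A : Set Plane}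
    (hA : MeasurableSet A) :
    Measurable fun ω => (pointCount (N ω) (fun k => x k ω) A : ℝ≥0∞) := by
  simp_rw [pointCount_eq_tsum]
  have hm := h.measurable_tsum (f := A.indicator 1) (measurable_one.indicator hA)
  convert! hm using 1
  refine funext fun ω => tsum_congr fun k => ?_
  classical
  simp only [Set.indicator_apply, Set.mem_ofPred_eq]
  by_cases hk : (k : ℕ∞) < N ω <;> simp [hk]

variable [IsProbabilityMeasure P]

/-- The generating function of the Poisson law with mean m. At q = 1 it says that the masses of the
finite values add up to one. -/
lemma tsum_pow_mul_poisson (m q : ℝ) (hm : 0 ≤ m) (hq : 0 ≤ q) :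
    ∑' n : ℕ, ENNReal.ofReal q ^ n * ENNReal.ofReal (Real.exp (-m) * m ^ n / n.factorial) =
      ENNReal.ofReal (Real.exp (-(m * (1 - q)))) := by
  have h1 : HasSum (fun n : ℕ => q ^ n * (Real.exp (-m) * m ^ n / n.factorial))
      (Real.exp (-(m * (1 - q)))) := by
    have := (NormedSpace.expSeries_div_hasSum_exp (𝔸 := ℝ) (m * q)).mul_left (Real.exp (-m))
    rw [← Real.exp_eq_exp_ℝ, ← Real.exp_add] at this
    convert! this using 1
    · ext n; rw [mul_pow]; ring
    · congr 1; ring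
  rw [← h1.tsum_eq, ENNReal.ofReal_tsum_of_nonneg _ h1.summable]
  · congr 1 with n
    rw [ENNReal.ofReal_mul (by positivity), ENNReal.ofReal_pow hq]
  · intro n; positivity

lemma IsPoissonProcess.lintegral_pointCount (h : IsPoissonProcess P N x Λ) {A : Set Plane}
    (hA : MeasurableSet A) (hΛ : Λ A ≠ ∞) (c : ℝ≥0∞) :
    ∫⁻ ω, expNeg ((pointCount (N ω) (fun k => x k ω) A : ℝ≥0∞) * c) ∂P =
      expNeg (Λ A * (1 - expNeg c)) := by
  classical
  set C : Ω → ℝ≥0∞ := fun ω => (pointCount (N ω) (fun k => x k ω) A : ℝ≥0∞) with hC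
  have hCm : Measurable C := h.measurable_pointCount hA
  set m := (Λ A).toReal
  have hm : 0 ≤ m := ENNReal.toReal_nonneg
  set w : ℕ → ℝ≥0∞ := fun n => ENNReal.ofReal (Real.exp (-m) * m ^ n / n.factorial)
  have hset : ∀ n : ℕ, {ω | C ω = n} = {ω | pointCount (N ω) (fun k => x k ω) A = n} := by
    intro n; ext ω
    simp only [hC, Set.mem_ofPred_eq]
    exact_mod_cast Iff.rfl
  have hlaw : ∀ n : ℕ, P {ω | C ω = n} = w n := fun n => by rw [hset, h.count_law A hA hΛ n]
  have hms : ∀ n : ℕ, MeasurableSet {ω | C ω = n} := fun n => hCm (measurableSet_singleton _)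
  have hdisj : Pairwise (Function.onFun Disjoint fun n : ℕ => {ω | C ω = n}) := by
    intro i j hij
    refine Set.disjoint_left.2 fun ω hi hj => hij ?_
    simp only [Set.mem_ofPred_eq] at hi hj
    exact_mod_cast hi.symm.trans hj
  -- `count_law` speaks only of finite counts; an infinite count is null because the Poisson masses
  -- already sum to one.
  have hU : P (⋃ n : ℕ, {ω | C ω = n})ᶜ = 0 := by
    rw [prob_compl_eq_zero_iff (MeasurableSet.iUnion hms), measure_iUnion hdisj hms]
    simp_rw [hlaw]
    simpa using tsum_pow_mul_poisson m 1 hm zero_le_one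
  have hq : ENNReal.ofReal (expNeg c).toReal = expNeg c := ENNReal.ofReal_toReal (expNeg_ne_top c)
  have hq1 : (expNeg c).toReal ≤ 1 := by
    simpa using ENNReal.toReal_mono ENNReal.one_ne_top (expNeg_le_one c)
  calc ∫⁻ ω, expNeg (C ω * c) ∂P
      = ∫⁻ ω in ⋃ n : ℕ, {ω | C ω = n}, expNeg (C ω * c) ∂P := by
        rw [Measure.restrict_eq_self_of_ae_mem]
        rw [ae_iff]
        exact hU
    _ = ∑' n : ℕ, ∫⁻ ω in {ω | C ω = n}, expNeg (C ω * c) ∂P := lintegral_iUnion hms hdisj _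
    _ = ∑' n : ℕ, expNeg c ^ n * w n := by
        congr 1 with n
        rw [setLIntegral_congr_fun (g := fun _ => expNeg c ^ n) (hms n), setLIntegral_const, hlaw]
        intro ω hω
        simp only [Set.mem_ofPred_eq] at hω
        simp only [hω, expNeg_natCast_mul]
    _ = ENNReal.ofReal (Real.exp (-(m * (1 - (expNeg c).toReal)))) := by
        rw [← tsum_pow_mul_poisson m _ hm ENNReal.toReal_nonneg, hq]
    _ = expNeg (Λ A * (1 - expNeg c)) := by
        rw [← expNeg_ofReal (mul_nonneg hm (by linarith)), ENNReal.ofReal_mul hm,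
          ENNReal.ofReal_toReal hΛ, ENNReal.ofReal_sub _ ENNReal.toReal_nonneg, hq,
          ENNReal.ofReal_one]

/-- The counts on the disjoint level sets are independent, so the integral factors into the case of
one set. -/
lemma IsPoissonProcess.laplace_simpleFunc (h : IsPoissonProcess P N x Λ)
    (g : SimpleFunc Plane ℝ≥0∞) (hg : ∀ c ≠ 0, Λ (g ⁻¹' {c}) ≠ ∞) :
    ∫⁻ ω, expNeg (∑' k : ℕ, (if (k : ℕ∞) < N ω then g (x k ω) else 0)) ∂P =
      expNeg (∫⁻ y, (1 - expNeg (g y)) ∂Λ) := by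
  classical
  set s := g.range.filter (· ≠ 0) with hs
  have e : Fin s.card ≃ s := s.equivFin.symm
  have hind := h.count_indep s.card (fun i => g ⁻¹' {(e i : ℝ≥0∞)})
    (fun i => g.measurableSet_preimage _) (by
      intro i j hij
      refine Disjoint.preimage _ (Set.disjoint_singleton.2 fun h => hij ?_)
      exact e.injective (Subtype.ext h))
  have hind' := hind.comp
    (fun i (n : ℕ∞) => expNeg ((n : ℝ≥0∞) * (e i : ℝ≥0∞))) (fun i => measurable_of_countable _)
  have hstep : ∀ ω, expNeg (∑' k : ℕ, (if (k : ℕ∞) < N ω then g (x k ω) else 0)) =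
      ∏ i : Fin s.card,
        expNeg ((pointCount (N ω) (fun k => x k ω) (g ⁻¹' {(e i : ℝ≥0∞)}) : ℝ≥0∞) * (e i : ℝ≥0∞)) := by
    intro ω
    rw [tsum_simpleFunc, expNeg_sum, ← hs, ← Finset.prod_coe_sort s]
    exact (Fintype.prod_equiv e _ _ fun i => rfl).symm
  simp_rw [hstep]
  have := lintegral_prod_eq_prod_lintegral_of_indepFun Finset.univ _ hind' (fun i => by
    refine measurable_expNeg.comp (Measurable.mul_const ?_ _)
    exact h.measurable_pointCount (g.measurableSet_preimage _))
  simp only [Function.comp_def] at this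
  rw [this]
  have hne : ∀ i, (e i : ℝ≥0∞) ≠ 0 := fun i => (Finset.mem_filter.1 (e i).2).2
  simp_rw [fun i => h.lintegral_pointCount (g.measurableSet_preimage {(e i : ℝ≥0∞)}) (hg _ (hne i))
    (e i : ℝ≥0∞)]
  rw [← expNeg_sum]
  congr 1
  have h1 : ∫⁻ y, (1 - expNeg (g y)) ∂Λ = (g.map fun c => 1 - expNeg c).lintegral Λ := by
    rw [← SimpleFunc.lintegral_eq_lintegral]; rfl
  rw [h1, SimpleFunc.map_lintegral]
  rw [Fintype.sum_equiv e _ (fun c : s => Λ (g ⁻¹' {(c : ℝ≥0∞)}) * (1 - expNeg c)) (fun i => rfl),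
    Finset.sum_coe_sort s (fun c => Λ (g ⁻¹' {c}) * (1 - expNeg c))]
  rw [hs, Finset.sum_filter]
  refine Finset.sum_congr rfl fun c _ => ?_
  by_cases hc : c = 0
  · simp [hc]
  · simp [hc, mul_comm]

/-- Both sides are continuous along an increasing sequence of simple functions. These are cut off to
the spanning sets so that their nonzero level sets have finite measure. -/
theorem IsPoissonProcess.laplace_functional [SigmaFinite Λ] (h : IsPoissonProcess P N x Λ)
    {f : Plane → ℝ≥0∞} (hf : Measurable f) :
    ∫⁻ ω, expNeg (∑' k : ℕ, (if (k : ℕ∞) < N ω then f (x k ω) else 0)) ∂P =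
      expNeg (∫⁻ y, (1 - expNeg (f y)) ∂Λ) := by
  classical
  set g : ℕ → SimpleFunc Plane ℝ≥0∞ := fun n => (SimpleFunc.eapprox f n).restrict (spanningSets Λ n)
  have hgapp : ∀ n y, g n y = (spanningSets Λ n).indicator (SimpleFunc.eapprox f n) y := fun n y =>
    SimpleFunc.restrict_apply _ (measurableSet_spanningSets Λ n) y
  have hgmono : ∀ y, Monotone fun n => g n y := by
    intro y n m hnm
    simp only [hgapp]
    refine (Set.indicator_le_indicator (SimpleFunc.monotone_eapprox f hnm y)).trans ?_
    exact Set.indicator_le_indicator_of_subset (monotone_spanningSets Λ hnm) (fun _ => zero_le) y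
  have hglim : ∀ y, Tendsto (fun n => g n y) atTop (𝓝 (f y)) := by
    intro y
    have h1 : Tendsto (fun n => SimpleFunc.eapprox f n y) atTop (𝓝 (f y)) :=
      SimpleFunc.tendsto_eapprox hf y
    refine h1.congr' ?_
    filter_upwards [eventually_ge_atTop (spanningSetsIndex Λ y)] with n hn
    rw [hgapp, Set.indicator_of_mem (mem_spanningSets_of_index_le Λ y hn)]
  have hgfin : ∀ n, ∀ c ≠ 0, Λ (g n ⁻¹' {c}) ≠ ∞ := by
    intro n c hc
    refine ((measure_mono ?_).trans_lt (measure_spanningSets_lt_top Λ n)).ne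
    intro y hy
    by_contra hny
    apply hc
    have : g n y = c := hy
    rw [← this, hgapp, Set.indicator_of_notMem hny]
  have hsum : ∀ ω, Tendsto (fun n => ∑' k : ℕ, (if (k : ℕ∞) < N ω then g n (x k ω) else 0)) atTop
      (𝓝 (∑' k : ℕ, (if (k : ℕ∞) < N ω then f (x k ω) else 0))) := by
    intro ω
    -- As an integral against counting measure, the sum over the points obeys monotone convergence.
    simp_rw [← lintegral_count]
    refine lintegral_tendsto_of_tendsto_of_monotone (fun n => Measurable.of_discrete.aemeasurable)
      (ae_of_all _ fun k => ?_) (ae_of_all _ fun k => ?_)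
    · intro n m hnm
      dsimp only
      split_ifs
      · exact hgmono _ hnm
      · exact le_rfl
    · split_ifs
      · exact hglim _
      · exact tendsto_const_nhds
  have hL : Tendsto (fun n => ∫⁻ ω, expNeg (∑' k : ℕ, (if (k : ℕ∞) < N ω then g n (x k ω) else 0)) ∂P)
      atTop (𝓝 (∫⁻ ω, expNeg (∑' k : ℕ, (if (k : ℕ∞) < N ω then f (x k ω) else 0)) ∂P)) := by
    refine tendsto_lintegral_of_dominated_convergence (fun _ => 1) (fun n => ?_) (fun n => ?_) ?_ ?_
    · exact measurable_expNeg.comp (h.measurable_tsum (g n).measurable)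
    · exact ae_of_all _ fun ω => expNeg_le_one _
    · simp
    · exact ae_of_all _ fun ω => (continuous_expNeg.tendsto _).comp (hsum ω)
  have hR : Tendsto (fun n => expNeg (∫⁻ y, (1 - expNeg (g n y)) ∂Λ)) atTop
      (𝓝 (expNeg (∫⁻ y, (1 - expNeg (f y)) ∂Λ))) := by
    refine (continuous_expNeg.tendsto _).comp ?_
    refine lintegral_tendsto_of_tendsto_of_monotone (fun n => ?_)
      (ae_of_all _ fun y => ?_) (ae_of_all _ fun y => ?_)
    · exact (measurable_const.sub (measurable_expNeg.comp (g n).measurable)).aemeasurable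
    · exact fun n m hnm => tsub_le_tsub_left (expNeg_antitone (hgmono y hnm)) _
    · exact ENNReal.Tendsto.sub tendsto_const_nhds ((continuous_expNeg.tendsto _).comp (hglim y))
        (Or.inl ENNReal.one_ne_top)
  simp_rw [fun n => h.laplace_simpleFunc (g n) (hgfin n)] at hL
  exact tendsto_nhds_unique hL hR

end Poisson

/-! ### Laplace transforms of the channel gains -/

lemma integral_exp_neg_sq_gaussianReal {t : ℝ} (ht : 0 ≤ t) {v : ℝ≥0} (hv : v ≠ 0) :
    ∫ x, Real.exp (-(t * x ^ 2)) ∂(gaussianReal 0 v) = (√(1 + 2 * t * v))⁻¹ := by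
  have hv' : (0 : ℝ) < v := by positivity
  rw [integral_gaussianReal_eq_integral_smul hv]
  have h1 : ∀ x : ℝ, gaussianPDFReal 0 v x • Real.exp (-(t * x ^ 2)) =
      (√(2 * Real.pi * v))⁻¹ * Real.exp (-(t + 1 / (2 * v)) * x ^ 2) := by
    intro x
    rw [gaussianPDFReal, smul_eq_mul, mul_assoc, ← Real.exp_add]
    congr 2
    field_simp
    ring
  simp_rw [h1]
  rw [integral_const_mul, integral_gaussian, ← Real.sqrt_inv, ← Real.sqrt_inv,
    ← Real.sqrt_mul (by positivity)]
  congr 1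
  have := Real.pi_pos
  field_simp
  ring

lemma lintegral_exp_neg_sq_gaussianReal {t : ℝ} (ht : 0 ≤ t) {v : ℝ≥0} (hv : v ≠ 0) :
    ∫⁻ x, ENNReal.ofReal (Real.exp (-(t * x ^ 2))) ∂(gaussianReal 0 v) =
      ENNReal.ofReal ((√(1 + 2 * t * v))⁻¹) := by
  rw [← integral_exp_neg_sq_gaussianReal ht hv, ofReal_integral_eq_lintegral_ofReal]
  · refine Integrable.of_bound (by fun_prop) 1 (ae_of_all _ fun x => ?_)
    rw [Real.norm_eq_abs, Real.abs_exp]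
    exact Real.exp_le_one_iff.2 (by have := mul_nonneg ht (sq_nonneg x); linarith)
  · exact ae_of_all _ fun x => (Real.exp_pos _).le

lemma measurable_complex_mk : Measurable (fun z : ℝ × ℝ => (⟨z.1, z.2⟩ : ℂ)) :=
  Complex.measurableEquivRealProd.symm.measurable

instance (v : ℝ≥0) : IsProbabilityMeasure (complexGaussian v) :=
  Measure.isProbabilityMeasure_map measurable_complex_mk.aemeasurable

instance (M : ℕ) : IsProbabilityMeasure (complexGaussianVector M) :=
  Measure.isProbabilityMeasure_map (WithLp.measurable_toLp 2 _).aemeasurable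

/-- Real and imaginary parts have variance v/2, and each contributes a factor (1 + tv)^{-1/2}. -/
lemma lintegral_exp_neg_complexGaussian {t : ℝ} (ht : 0 ≤ t) {v : ℝ≥0} (hv : v ≠ 0) :
    ∫⁻ z, ENNReal.ofReal (Real.exp (-(t * ‖z‖ ^ 2))) ∂(complexGaussian v) =
      ENNReal.ofReal ((1 + t * v)⁻¹) := by
  rw [complexGaussian, lintegral_map (by fun_prop) measurable_complex_mk]
  have h1 : ∀ z : ℝ × ℝ, ENNReal.ofReal (Real.exp (-(t * ‖(⟨z.1, z.2⟩ : ℂ)‖ ^ 2))) =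
      ENNReal.ofReal (Real.exp (-(t * z.1 ^ 2))) * ENNReal.ofReal (Real.exp (-(t * z.2 ^ 2))) := by
    intro z
    rw [← ENNReal.ofReal_mul (Real.exp_pos _).le, ← Real.exp_add, Complex.sq_norm,
      Complex.normSq_mk]
    congr 2
    ring
  simp_rw [h1]
  have hv2 : v / 2 ≠ 0 := by positivity
  rw [lintegral_prod_mul (f := fun y : ℝ => ENNReal.ofReal (Real.exp (-(t * y ^ 2))))
    (g := fun y : ℝ => ENNReal.ofReal (Real.exp (-(t * y ^ 2)))) (by fun_prop) (by fun_prop),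
    lintegral_exp_neg_sq_gaussianReal ht hv2,
    ← ENNReal.ofReal_mul (by positivity), ← mul_inv, Real.mul_self_sqrt (by positivity)]
  congr 2
  push_cast
  ring

lemma lintegral_exp_neg_complexGaussianVector {t : ℝ} (ht : 0 ≤ t) (M : ℕ) :
    ∫⁻ h, ENNReal.ofReal (Real.exp (-(t * ‖h‖ ^ 2))) ∂(complexGaussianVector M) =
      ENNReal.ofReal (((1 + t) ^ M)⁻¹) := by
  rw [complexGaussianVector, lintegral_map (by fun_prop) (WithLp.measurable_toLp 2 _)]
  have h1 : ∀ v : Fin M → ℂ, ENNReal.ofReal (Real.exp (-(t * ‖WithLp.toLp 2 v‖ ^ 2))) =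
      ∏ i, ENNReal.ofReal (Real.exp (-(t * ‖v i‖ ^ 2))) := by
    intro v
    rw [← ENNReal.ofReal_prod_of_nonneg (fun _ _ => (Real.exp_pos _).le), ← Real.exp_sum,
      EuclideanSpace.norm_sq_eq, Finset.sum_neg_distrib, Finset.mul_sum]
  simp_rw [h1]
  have hind : iIndepFun (fun (i : Fin M) (v : Fin M → ℂ) =>
      ENNReal.ofReal (Real.exp (-(t * ‖v i‖ ^ 2)))) (Measure.pi fun _ : Fin M => complexGaussian 1) :=
    iIndepFun_pi (X := fun _ z => ENNReal.ofReal (Real.exp (-(t * ‖z‖ ^ 2)))) (fun i => by fun_prop)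
  rw [lintegral_prod_eq_prod_lintegral_of_indepFun _ _ hind (fun i => by fun_prop)]
  have h2 : ∀ i : Fin M, ∫⁻ v, ENNReal.ofReal (Real.exp (-(t * ‖v i‖ ^ 2)))
      ∂(Measure.pi fun _ : Fin M => complexGaussian 1) = ENNReal.ofReal ((1 + t)⁻¹) := by
    intro i
    rw [(measurePreserving_eval (fun _ : Fin M => complexGaussian 1) i).lintegral_comp
      (f := fun z => ENNReal.ofReal (Real.exp (-(t * ‖z‖ ^ 2)))) (by fun_prop),
      lintegral_exp_neg_complexGaussian ht one_ne_zero]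
    simp
  simp_rw [h2]
  rw [Finset.prod_const, Finset.card_univ, Fintype.card_fin, ← ENNReal.ofReal_pow (by positivity),
    inv_pow]

/-- The beamformer is aligned with the channel and collects all its energy. At h = 0 both sides
vanish, so no null set has to be excluded. -/
lemma norm_inner_mrt {M : ℕ} (h : EuclideanSpace ℂ (Fin M)) :
    ‖inner ℂ h (mrt h)‖ ^ 2 = ‖h‖ ^ 2 := by
  rw [mrt, inner_smul_right, inner_self_eq_norm_sq_to_K, norm_mul, norm_inv, norm_pow]
  simp only [Complex.coe_algebraMap, Complex.norm_real, norm_norm]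
  rcases eq_or_ne ‖h‖ 0 with h0 | h0
  · simp [h0]
  · field_simp

/-! ### An integral representation of the logarithm -/

/-- The quotient is ∫_a^b e^{-tz} dt; after swapping the integrals, the one in z is 1/t. -/
lemma lintegral_frullani {a b : ℝ} (ha : 0 < a) (hab : a ≤ b) :
    ∫⁻ z in Set.Ioi (0 : ℝ), ENNReal.ofReal ((Real.exp (-(a * z)) - Real.exp (-(b * z))) / z) =
      ENNReal.ofReal (Real.log (b / a)) := by
  have hb : 0 < b := ha.trans_le hab
  have h1 : ∀ z ∈ Set.Ioi (0 : ℝ),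
      ENNReal.ofReal ((Real.exp (-(a * z)) - Real.exp (-(b * z))) / z) =
        ∫⁻ t in Set.Ioc a b, ENNReal.ofReal (Real.exp (-(t * z))) := by
    intro z hz
    have hz : 0 < z := hz
    have hd : ∀ t ∈ Set.uIcc a b,
        HasDerivAt (fun t => -Real.exp (-(t * z)) / z) (Real.exp (-(t * z))) t := by
      intro t _
      have := (((hasDerivAt_id t).mul_const z).neg.exp.neg).div_const z
      convert! this using 1
      simp only [Pi.neg_apply, id]
      field_simp
    have hi : IntervalIntegrable (fun t => Real.exp (-(t * z))) volume a b :=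
      Continuous.intervalIntegrable (by fun_prop) _ _
    have := intervalIntegral.integral_eq_sub_of_hasDerivAt hd hi
    rw [intervalIntegral.integral_of_le hab] at this
    rw [← ofReal_integral_eq_lintegral_ofReal hi.1 (ae_of_all _ fun t => (Real.exp_pos _).le), this]
    congr 1
    ring
  rw [setLIntegral_congr_fun measurableSet_Ioi h1, lintegral_lintegral_swap (by fun_prop)]
  have h2 : ∀ t ∈ Set.Ioc a b, ∫⁻ z in Set.Ioi (0 : ℝ), ENNReal.ofReal (Real.exp (-(t * z))) =
      ENNReal.ofReal t⁻¹ := by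
    intro t ht
    have ht : 0 < t := ha.trans ht.1
    have hi := integrableOn_exp_mul_Ioi (neg_lt_zero.2 ht) 0
    have hv := integral_exp_mul_Ioi (neg_lt_zero.2 ht) 0
    simp only [neg_mul] at hi hv
    rw [← ofReal_integral_eq_lintegral_ofReal hi (ae_of_all _ fun t => (Real.exp_pos _).le), hv]
    congr 1
    simp
  rw [setLIntegral_congr_fun measurableSet_Ioc h2, ← ofReal_integral_eq_lintegral_ofReal,
    ← intervalIntegral.integral_of_le hab, integral_inv_of_pos ha hb]
  · exact (intervalIntegral.intervalIntegrable_inv (fun x hx => by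
      rw [Set.uIcc_of_le hab] at hx; exact (ha.trans_le hx.1).ne') continuousOn_id).1
  · refine (ae_restrict_iff' measurableSet_Ioc).2 (ae_of_all _ fun t ht => ?_)
    exact (inv_pos.2 (ha.trans ht.1)).le

/-- The kernel `e^{-z} / z · e^{-z V} (1 - e^{-z X})`. -/
noncomputable def logKernel (V X : ℝ≥0∞) (z : ℝ) : ℝ≥0∞ :=
  ENNReal.ofReal (Real.exp (-z) / z) *
    (expNeg (ENNReal.ofReal z * V) * (1 - expNeg (ENNReal.ofReal z * X)))

/-- Frullani with a = V + 1 and b = V + 1 + X. -/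
lemma lintegral_logKernel_ofReal {V X : ℝ} (hV : 0 ≤ V) (hX : 0 ≤ X) :
    ∫⁻ z in Set.Ioi (0 : ℝ), logKernel (ENNReal.ofReal V) (ENNReal.ofReal X) z =
      ENNReal.ofReal (Real.log (1 + X / (V + 1))) := by
  have h := lintegral_frullani (a := V + 1) (b := V + 1 + X) (by positivity) (by linarith)
  rw [show 1 + X / (V + 1) = (V + 1 + X) / (V + 1) by field_simp, ← h]
  refine setLIntegral_congr_fun measurableSet_Ioi fun z hz => ?_
  have hz : 0 < z := hz
  simp only [logKernel]
  rw [← ENNReal.ofReal_mul hz.le, ← ENNReal.ofReal_mul hz.le, one_sub_expNeg_ofReal (by positivity),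
    expNeg_ofReal (by positivity), ← ENNReal.ofReal_mul (by positivity),
    ← ENNReal.ofReal_mul (by positivity)]
  congr 1
  have e1 : Real.exp (-((V + 1) * z)) = Real.exp (-z) * Real.exp (-(z * V)) := by
    rw [← Real.exp_add]; congr 1; ring
  have e2 : Real.exp (-((V + 1 + X) * z)) =
      Real.exp (-z) * Real.exp (-(z * V)) * Real.exp (-(z * X)) := by
    rw [← Real.exp_add, ← Real.exp_add]; congr 1; ring
  rw [e1, e2]
  ring

lemma logKernel_mono {V X Y : ℝ≥0∞} (h : X ≤ Y) (z : ℝ) : logKernel V X z ≤ logKernel V Y z := by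
  unfold logKernel
  gcongr
  exact expNeg_antitone (by gcongr)

/-- Infinite power is detected by an infinite integral: the kernel at ∞ dominates the kernel at
every n, and these have integrals tending to ∞. -/
lemma lintegral_logKernel_top {V : ℝ} (hV : 0 ≤ V) :
    ∫⁻ z in Set.Ioi (0 : ℝ), logKernel (ENNReal.ofReal V) ∞ z = ∞ := by
  by_contra hne
  have h1 : ∀ n : ℕ, ENNReal.ofReal (Real.log (1 + n / (V + 1))) ≤
      ∫⁻ z in Set.Ioi (0 : ℝ), logKernel (ENNReal.ofReal V) ∞ z := by
    intro n
    rw [← lintegral_logKernel_ofReal hV n.cast_nonneg]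
    exact lintegral_mono fun z => logKernel_mono le_top z
  have h2 : Tendsto (fun n : ℕ => ENNReal.ofReal (Real.log (1 + n / (V + 1)))) atTop (𝓝 ∞) := by
    refine ENNReal.tendsto_ofReal_atTop.comp (Real.tendsto_log_atTop.comp ?_)
    refine tendsto_atTop_add_const_left _ _ (Tendsto.atTop_div_const (by positivity) ?_)
    exact tendsto_natCast_atTop_atTop
  exact hne (top_le_iff.1 (le_of_tendsto' h2 h1))

lemma measurable_logKernel : Measurable fun q : (ℝ≥0∞ × ℝ≥0∞) × ℝ => logKernel q.1.1 q.1.2 q.2 := by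
  unfold logKernel
  have := measurable_expNeg
  fun_prop

/-! ### Conditioning on independent variables -/

section Indep

variable {Ω α β γ δ : Type*} [MeasurableSpace Ω] [MeasurableSpace α] [MeasurableSpace β]
  [MeasurableSpace γ] [MeasurableSpace δ] {P : Measure Ω} [IsProbabilityMeasure P]

lemma lintegral_of_indepFun {X : Ω → α} {Y : Ω → β} (h : IndepFun X Y P) (hX : Measurable X)
    (hY : Measurable Y) {F : α × β → ℝ≥0∞} (hF : Measurable F) :
    ∫⁻ ω, F (X ω, Y ω) ∂P = ∫⁻ ω, ∫⁻ ω', F (X ω, Y ω') ∂P ∂P := by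
  rw [← lintegral_map hF (hX.prodMk hY), h.map_prod_eq_prod_map_map hX.aemeasurable hY.aemeasurable,
    lintegral_prod _ hF.aemeasurable, lintegral_map hF.lintegral_prod_right' hX]
  congr 1 with ω
  rw [lintegral_map (f := fun y => F (X ω, y)) (by fun_prop) hY]

/-- The conditional expectation, given `X`, of a product of factors that depend on `X` and on
independent marks `(B k, H k)`. -/
lemma lintegral_prod_marks {X : Ω → α} {B : ℕ → Ω → β} {H : ℕ → Ω → γ} {L : Ω → δ}
    (hX : Measurable X) (hB : ∀ k, Measurable (B k)) (hH : ∀ k, Measurable (H k))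
    (hL : Measurable L)
    (hXm : IndepFun X (fun ω => ((fun k => B k ω), (fun k => H k ω), L ω)) P)
    (hBm : IndepFun (fun ω k => B k ω) (fun ω => ((fun k => H k ω), L ω)) P)
    (hHL : IndepFun (fun ω k => H k ω) L P)
    (hBi : iIndepFun B P) (hHi : iIndepFun H P)
    {φ : ℕ → α × β × γ → ℝ≥0∞} (hφ : ∀ k, Measurable (φ k)) {G : δ → ℝ≥0∞} (hG : Measurable G)
    (n : ℕ) :
    ∫⁻ ω, (∏ k ∈ Finset.range n, φ k (X ω, B k ω, H k ω)) * G (L ω) ∂P =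
      (∫⁻ ω, ∏ k ∈ Finset.range n, ∫⁻ ω', ∫⁻ ω'', φ k (X ω, B k ω', H k ω'') ∂P ∂P ∂P) *
        ∫⁻ ω, G (L ω) ∂P := by
  have hBs : Measurable fun ω k => B k ω := measurable_pi_lambda _ hB
  have hHs : Measurable fun ω k => H k ω := measurable_pi_lambda _ hH
  -- Independence is used in layers: X from all the rest, the marks from (H, L), H from L, and last
  -- the coordinates of H and of B among themselves.
  have h1 := lintegral_of_indepFun hXm hX (hBs.prodMk (hHs.prodMk hL))
    (F := fun q => (∏ k ∈ Finset.range n, φ k (q.1, q.2.1 k, q.2.2.1 k)) * G q.2.2.2) (by fun_prop)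
  have hψ : ∀ k, Measurable fun a => ∫⁻ ω', ∫⁻ ω'', φ k (a, B k ω', H k ω'') ∂P ∂P := by
    intro k
    exact Measurable.lintegral_prod_right'
      (f := fun q : α × Ω => ∫⁻ ω'', φ k (q.1, B k q.2, H k ω'') ∂P)
      (Measurable.lintegral_prod_right'
        (f := fun r : (α × Ω) × Ω => φ k (r.1.1, B k r.1.2, H k r.2)) (by fun_prop))
  rw [h1, ← lintegral_mul_const]
  swap
  · exact Finset.measurable_fun_prod _ fun k _ => (hψ k).comp hX
  refine lintegral_congr fun ω => ?_
  have h2 := lintegral_of_indepFun hBm hBs (hHs.prodMk hL)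
    (F := fun q => (∏ k ∈ Finset.range n, φ k (X ω, q.1 k, q.2.1 k)) * G q.2.2) (by fun_prop)
  rw [h2]
  have h3 : ∀ ω', ∫⁻ ω'', (∏ k ∈ Finset.range n, φ k (X ω, B k ω', H k ω'')) * G (L ω'') ∂P =
      (∏ k ∈ Finset.range n, ∫⁻ ω'', φ k (X ω, B k ω', H k ω'') ∂P) * ∫⁻ ω, G (L ω) ∂P := by
    intro ω'
    have h4 := lintegral_mul_eq_lintegral_mul_lintegral_of_indepFun
      (f := fun ω'' => ∏ k ∈ Finset.range n, φ k (X ω, B k ω', H k ω''))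
      (g := fun ω'' => G (L ω'')) (μ := P) (by fun_prop) (by fun_prop)
      (hHL.comp (φ := fun h : ℕ → γ => ∏ k ∈ Finset.range n, φ k (X ω, B k ω', h k)) (by fun_prop) hG)
    simp only [Pi.mul_apply] at h4
    rw [h4]
    congr 1
    exact lintegral_prod_eq_prod_lintegral_of_indepFun _ _
      (hHi.comp (fun k h => φ k (X ω, B k ω', h)) (fun k => by fun_prop)) (fun k => by fun_prop)
  simp only [] at h3 ⊢
  simp_rw [h3]
  have hm : ∀ k, Measurable fun b : β => ∫⁻ ω'', φ k (X ω, b, H k ω'') ∂P := by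
    intro k
    exact Measurable.lintegral_prod_right' (f := fun q : β × Ω => φ k (X ω, q.1, H k q.2))
      (by fun_prop)
  rw [lintegral_mul_const]
  swap
  · exact Finset.measurable_fun_prod _ fun k _ => (hm k).comp (hB k)
  congr 1
  exact lintegral_prod_eq_prod_lintegral_of_indepFun _ _
    (hBi.comp (fun k b => ∫⁻ ω'', φ k (X ω, b, H k ω'') ∂P) hm) (fun k => (hm k).comp (hB k))

end Indep

/-! ### The Laplace transform of the received power -/

lemma measurable_pathLoss (ε α : ℝ) : Measurable (pathLoss ε α) := by
  unfold pathLoss; fun_prop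

lemma pathLoss_nonneg {ε : ℝ} (hε : 0 ≤ ε) (α : ℝ) (y : Plane) : 0 ≤ pathLoss ε α y := by
  unfold pathLoss; positivity

/-- The Laplace transform at `z` of the power received from a transmitter at `y`. -/
noncomputable def gainLaplace (M : ℕ) (ε α Pb z : ℝ) (y : Plane) : ℝ :=
  ((1 + z * (Pb * pathLoss ε α y)) ^ M)⁻¹

lemma measurable_gainLaplace (M : ℕ) (ε α Pb z : ℝ) : Measurable (gainLaplace M ε α Pb z) := by
  have := measurable_pathLoss ε α
  unfold gainLaplace; fun_prop

lemma gainLaplace_pos {M : ℕ} {ε α Pb z : ℝ} (hε : 0 ≤ ε) (hPb : 0 ≤ Pb) (hz : 0 ≤ z) (y : Plane) :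
    0 < gainLaplace M ε α Pb z y := by
  have := pathLoss_nonneg hε α y
  unfold gainLaplace; positivity

lemma gainLaplace_le_one {M : ℕ} {ε α Pb z : ℝ} (hε : 0 ≤ ε) (hPb : 0 ≤ Pb) (hz : 0 ≤ z)
    (y : Plane) : gainLaplace M ε α Pb z y ≤ 1 := by
  have := pathLoss_nonneg hε α y
  refine inv_le_one_of_one_le₀ (one_le_pow₀ ?_)
  have : 0 ≤ z * (Pb * pathLoss ε α y) := by positivity
  linarith

/-- The exponent of the Laplace transform of the power received from the downlink RRHs in `A`. -/
noncomputable def exponent (M : ℕ) (lam p : ℝ) (D : Set Plane) (ε α Pb : ℝ) (A : Set Plane)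
    (z : ℝ) : ℝ≥0∞ :=
  ENNReal.ofReal (p * lam) * ∫⁻ y in A ∩ D, ENNReal.ofReal (1 - gainLaplace M ε α Pb z y)

namespace Network

variable {Ω : Type*} [MeasurableSpace Ω] {P : Measure Ω} {M : ℕ}
  {lam p σ : ℝ} {D : Set Plane}

lemma measurable_points (S : Network P M lam p σ D) : Measurable fun ω => (S.N ω, fun k => S.x k ω) :=
  S.poisson.measurable_number.prodMk (measurable_pi_lambda _ S.poisson.measurable_point)

lemma receivedPower_nonneg (S : Network P M lam p σ D) {ε α Pb : ℝ} (hε : 0 ≤ ε) (hPb : 0 ≤ Pb)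
    (A : Set Plane) (k : ℕ) (ω : Ω) : 0 ≤ S.receivedPower ε α Pb A k ω := by
  unfold receivedPower
  have := pathLoss_nonneg hε α (S.x k ω)
  split_ifs <;> positivity

lemma receivedPower_mono (S : Network P M lam p σ D) {ε α Pb : ℝ} (hε : 0 ≤ ε) (hPb : 0 ≤ Pb)
    {A A' : Set Plane} (h : A ⊆ A') (k : ℕ) (ω : Ω) :
    S.receivedPower ε α Pb A k ω ≤ S.receivedPower ε α Pb A' k ω := by
  by_cases h1 : (k : ℕ∞) < S.N ω ∧ S.B k ω = true ∧ S.x k ω ∈ A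
  · rw [receivedPower, receivedPower, if_pos h1, if_pos ⟨h1.1, h1.2.1, h h1.2.2⟩]
  · rw [receivedPower, if_neg h1]
    exact S.receivedPower_nonneg hε hPb _ _ _

lemma measurableSet_active (S : Network P M lam p σ D) {A : Set Plane} (hA : MeasurableSet A)
    (k : ℕ) : MeasurableSet {ω | (k : ℕ∞) < S.N ω ∧ S.B k ω = true ∧ S.x k ω ∈ A} := by
  refine MeasurableSet.inter ?_ (MeasurableSet.inter ?_ ?_)
  · exact S.poisson.measurable_number (MeasurableSet.of_discrete (s := Set.Ioi (k : ℕ∞)))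
  · exact S.measurable_B k (measurableSet_singleton true)
  · exact S.poisson.measurable_point k hA

lemma measurable_receivedPower (S : Network P M lam p σ D) (ε α Pb : ℝ) {A : Set Plane}
    (hA : MeasurableSet A) (k : ℕ) : Measurable (S.receivedPower ε α Pb A k) := by
  classical
  unfold receivedPower
  simp_rw [norm_inner_mrt]
  refine Measurable.ite (S.measurableSet_active hA k) ?_ measurable_const
  have h1 := (measurable_pathLoss ε α).comp (S.poisson.measurable_point k)
  have h2 := S.measurable_h k
  simp only [Function.comp_def] at h1
  fun_prop

/-- The total received power, as an element of `[0, ∞]`. -/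
noncomputable def totalPower (S : Network P M lam p σ D) (ε α Pb : ℝ) (A : Set Plane) (ω : Ω) :
    ℝ≥0∞ :=
  ∑' k, ENNReal.ofReal (S.receivedPower ε α Pb A k ω)

lemma measurable_totalPower (S : Network P M lam p σ D) (ε α Pb : ℝ) {A : Set Plane}
    (hA : MeasurableSet A) : Measurable (S.totalPower ε α Pb A) :=
  Measurable.tsum fun k => (S.measurable_receivedPower ε α Pb hA k).ennreal_ofReal

variable [IsProbabilityMeasure P]

lemma lintegral_mark (S : Network P M lam p σ D) (hp : p ∈ Set.Icc (0 : ℝ) 1) (k : ℕ) {c : ℝ}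
    (hc : 0 ≤ c) :
    ∫⁻ ω, (if S.B k ω = true then ENNReal.ofReal c else 1) ∂P =
      ENNReal.ofReal (1 - p * (1 - c)) := by
  have hm : MeasurableSet {ω | S.B k ω = true} := S.measurable_B k (measurableSet_singleton true)
  rw [← lintegral_add_compl _ hm,
    setLIntegral_congr_fun (f := fun ω => if S.B k ω = true then ENNReal.ofReal c else 1)
      (g := fun _ => ENNReal.ofReal c) hm (fun ω hω => if_pos hω),
    setLIntegral_congr_fun (f := fun ω => if S.B k ω = true then ENNReal.ofReal c else 1)
      (g := fun _ => 1) hm.compl (fun ω hω => if_neg hω),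
    setLIntegral_const, setLIntegral_const, prob_compl_eq_one_sub hm, S.B_law,
    ← ENNReal.ofReal_mul hc, one_mul, ← ENNReal.ofReal_one, ← ENNReal.ofReal_sub _ hp.1,
    ← ENNReal.ofReal_add (mul_nonneg hc hp.1) (by linarith [hp.2])]
  congr 1
  ring

omit [IsProbabilityMeasure P] in
lemma lintegral_exp_neg_loop (S : Network P M lam p σ D) (hσ : 0 < σ) {t : ℝ} (ht : 0 ≤ t) :
    ∫⁻ ω, ENNReal.ofReal (Real.exp (-(t * ‖S.hLI ω‖ ^ 2))) ∂P = ENNReal.ofReal ((1 + t * σ)⁻¹) := by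
  rw [← lintegral_map (f := fun h : ℂ => ENNReal.ofReal (Real.exp (-(t * ‖h‖ ^ 2)))) (by fun_prop)
    S.measurable_hLI, S.hLI_law, lintegral_exp_neg_complexGaussian ht (by simpa using hσ),
    Real.coe_toNNReal _ hσ.le]

open Classical in
lemma lintegral_factor (S : Network P M lam p σ D) (hp : p ∈ Set.Icc (0 : ℝ) 1) {ε α Pb z : ℝ}
    (hε : 0 ≤ ε) (hPb : 0 ≤ Pb) (hz : 0 ≤ z) (A : Set Plane) (k : ℕ) (N : ℕ∞) (y : Plane) :
    ∫⁻ ω', ∫⁻ ω'', (if (k : ℕ∞) < N ∧ S.B k ω' = true ∧ y ∈ A then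
        ENNReal.ofReal (Real.exp (-(z * (Pb * pathLoss ε α y) * ‖S.h k ω''‖ ^ 2))) else 1) ∂P ∂P =
      if (k : ℕ∞) < N ∧ y ∈ A then
        ENNReal.ofReal (1 - p * (1 - gainLaplace M ε α Pb z y)) else 1 := by
  by_cases h : (k : ℕ∞) < N ∧ y ∈ A
  · rw [if_pos h, ← S.lintegral_mark hp k (gainLaplace_pos hε hPb hz y).le]
    refine lintegral_congr fun ω' => ?_
    simp only [h, true_and, and_true]
    by_cases hB : S.B k ω' = true
    · simp only [hB, if_true]
      have ht : 0 ≤ z * (Pb * pathLoss ε α y) :=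
        mul_nonneg hz (mul_nonneg hPb (pathLoss_nonneg hε α y))
      rw [gainLaplace, ← lintegral_exp_neg_complexGaussianVector ht, ← S.h_law k,
        lintegral_map (by fun_prop) (S.measurable_h k)]
    · simp [hB]
  · rw [if_neg h]
    have : ∀ ω', ¬ ((k : ℕ∞) < N ∧ S.B k ω' = true ∧ y ∈ A) := fun ω' h' => h ⟨h'.1, h'.2.2⟩
    simp [this]

omit [IsProbabilityMeasure P] in
open Classical in
lemma expNeg_receivedPower (S : Network P M lam p σ D) {ε α Pb z : ℝ} (hε : 0 ≤ ε) (hPb : 0 ≤ Pb)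
    (hz : 0 ≤ z) (A : Set Plane) (k : ℕ) (ω : Ω) :
    expNeg (ENNReal.ofReal z * ENNReal.ofReal (S.receivedPower ε α Pb A k ω)) =
      if (k : ℕ∞) < S.N ω ∧ S.B k ω = true ∧ S.x k ω ∈ A then
        ENNReal.ofReal (Real.exp (-(z * (Pb * pathLoss ε α (S.x k ω)) * ‖S.h k ω‖ ^ 2))) else 1 := by
  rw [← ENNReal.ofReal_mul hz,
    expNeg_ofReal (mul_nonneg hz (S.receivedPower_nonneg hε hPb A k ω)), receivedPower]
  split_ifs
  · rw [norm_inner_mrt]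
    congr 3
    ring
  · simp

/-- The negative logarithm of the conditional Laplace transform, given the locations, of the power
received from an RRH at a point of `A`. -/
noncomputable def logFactor (M : ℕ) (p ε α Pb z : ℝ) (A : Set Plane) : Plane → ℝ≥0∞ :=
  A.indicator fun y => ENNReal.ofReal (-Real.log (1 - p * (1 - gainLaplace M ε α Pb z y)))

omit [IsProbabilityMeasure P] in
lemma expNeg_logFactor {p ε α Pb z : ℝ} (hp : p ∈ Set.Icc (0 : ℝ) 1) (hε : 0 ≤ ε) (hPb : 0 ≤ Pb)
    (hz : 0 ≤ z) {A : Set Plane} {y : Plane} (hy : y ∈ A) :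
    expNeg (logFactor M p ε α Pb z A y) =
      ENNReal.ofReal (1 - p * (1 - gainLaplace M ε α Pb z y)) := by
  have h1 := gainLaplace_pos (M := M) (α := α) hε hPb hz y
  have h2 := gainLaplace_le_one (M := M) (α := α) hε hPb hz y
  -- Even for p = 1 this is positive, since the transform of the gain is; so the logarithm is not a
  -- default value.
  have h3 : 0 < 1 - p * (1 - gainLaplace M ε α Pb z y) := by nlinarith [hp.1, hp.2]
  have h4 : 1 - p * (1 - gainLaplace M ε α Pb z y) ≤ 1 := by nlinarith [hp.1, hp.2]
  rw [logFactor, Set.indicator_of_mem hy,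
    expNeg_ofReal (neg_nonneg.2 (Real.log_nonpos h3.le h4)), neg_neg, Real.exp_log h3]

/-- For the first n indices, averaging over marks and channels given the locations leaves a product
of factors e^{-f(x_k)} with f = `logFactor`. As n → ∞ this becomes the Laplace functional of f. -/
theorem laplace_totalPower (S : Network P M lam p σ D) (hlam : 0 < lam) (hp : p ∈ Set.Icc (0 : ℝ) 1)
    (hσ : 0 < σ) {ε α Pb Pu z : ℝ} (hε : 0 ≤ ε) (hPb : 0 ≤ Pb) (hPu : 0 ≤ Pu) (hz : 0 ≤ z)
    {A : Set Plane} (hA : MeasurableSet A) :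
    ∫⁻ ω, expNeg (ENNReal.ofReal z * S.totalPower ε α Pb A ω) *
        expNeg (ENNReal.ofReal z * ENNReal.ofReal (Pu * ‖S.hLI ω‖ ^ 2)) ∂P =
      expNeg (exponent M lam p D ε α Pb A z) * ENNReal.ofReal ((1 + Pu * σ * z)⁻¹) := by
  classical
  have hBm := S.measurable_B
  have hhm := S.measurable_h
  have hLm := S.measurable_hLI
  set G : ℂ → ℝ≥0∞ := fun h => ENNReal.ofReal (Real.exp (-(z * Pu * ‖h‖ ^ 2))) with hG
  have hGm : Measurable G := by fun_prop
  have hloop : ∀ ω, expNeg (ENNReal.ofReal z * ENNReal.ofReal (Pu * ‖S.hLI ω‖ ^ 2)) =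
      G (S.hLI ω) := by
    intro ω
    rw [← ENNReal.ofReal_mul hz, expNeg_ofReal (by positivity)]
    simp only [hG, mul_assoc]
  have hGI : ∫⁻ ω, G (S.hLI ω) ∂P = ENNReal.ofReal ((1 + Pu * σ * z)⁻¹) := by
    rw [hG, S.lintegral_exp_neg_loop hσ (by positivity)]
    congr 2
    ring
  set φ : ℕ → (ℕ∞ × (ℕ → Plane)) × Bool × EuclideanSpace ℂ (Fin M) → ℝ≥0∞ := fun k q =>
    if (k : ℕ∞) < q.1.1 ∧ q.2.1 = true ∧ q.1.2 k ∈ A then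
      ENNReal.ofReal (Real.exp (-(z * (Pb * pathLoss ε α (q.1.2 k)) * ‖q.2.2‖ ^ 2))) else 1 with hφ
  have hφm : ∀ k, Measurable (φ k) := by
    intro k
    refine Measurable.ite (MeasurableSet.inter ?_ (MeasurableSet.inter ?_ ?_)) ?_ measurable_const
    · exact (measurable_fst.comp measurable_fst)
        (MeasurableSet.of_discrete (s := Set.Ioi (k : ℕ∞)))
    · exact (measurable_fst.comp measurable_snd) (measurableSet_singleton true)
    · exact ((measurable_pi_apply k).comp (measurable_snd.comp measurable_fst)) hA
    · have := measurable_pathLoss ε α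
      fun_prop
  have hfin := fun n => lintegral_prod_marks S.measurable_points hBm hhm hLm S.indep_points
    S.indep_marks S.indep_channels S.B_indep S.h_indep hφm hGm n
  set f := logFactor M p ε α Pb z A with hf
  have hfm : Measurable f := by
    have := measurable_gainLaplace M ε α Pb z
    exact Measurable.indicator (by fun_prop) hA
  have hfac : ∀ k ω, ∫⁻ ω', ∫⁻ ω'', φ k ((S.N ω, fun k => S.x k ω), S.B k ω', S.h k ω'') ∂P ∂P =
      expNeg (if (k : ℕ∞) < S.N ω then f (S.x k ω) else 0) := by
    intro k ω
    rw [hφ]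
    rw [S.lintegral_factor hp hε hPb hz A k (S.N ω) (S.x k ω)]
    by_cases h1 : (k : ℕ∞) < S.N ω
    · by_cases h2 : S.x k ω ∈ A
      · simp only [h1, h2, and_self, if_true]
        exact (expNeg_logFactor hp hε hPb hz h2).symm
      · simp [h1, h2, hf, logFactor]
    · simp [h1]
  simp_rw [hfac, hGI] at hfin
  have hprod : ∀ n ω, ∏ k ∈ Finset.range n, φ k ((S.N ω, fun k => S.x k ω), S.B k ω, S.h k ω) =
      ∏ k ∈ Finset.range n,
        expNeg (ENNReal.ofReal z * ENNReal.ofReal (S.receivedPower ε α Pb A k ω)) := by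
    intro n ω
    exact Finset.prod_congr rfl fun k _ => (S.expNeg_receivedPower hε hPb hz A k ω).symm
  simp_rw [hprod] at hfin
  have hrm := fun k => S.measurable_receivedPower ε α Pb hA k
  have hem := measurable_expNeg
  have hL : Tendsto (fun n => ∫⁻ ω, (∏ k ∈ Finset.range n,
      expNeg (ENNReal.ofReal z * ENNReal.ofReal (S.receivedPower ε α Pb A k ω))) * G (S.hLI ω) ∂P)
      atTop (𝓝 (∫⁻ ω, expNeg (ENNReal.ofReal z * S.totalPower ε α Pb A ω) * G (S.hLI ω) ∂P)) := by
    refine tendsto_lintegral_of_dominated_convergence (fun _ => 1) (fun n => by fun_prop)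
      (fun n => ae_of_all _ fun ω => ?_) (by simp) (ae_of_all _ fun ω => ?_)
    · refine mul_le_one' (Finset.prod_le_one' fun k _ => expNeg_le_one _) ?_
      rw [← hloop]
      exact expNeg_le_one _
    · rw [totalPower, ← ENNReal.tsum_mul_left]
      refine ENNReal.Tendsto.mul_const (tendsto_expNeg_sum _) (Or.inr ENNReal.ofReal_ne_top)
  have hR : Tendsto (fun n => (∫⁻ ω, ∏ k ∈ Finset.range n,
      expNeg (if (k : ℕ∞) < S.N ω then f (S.x k ω) else 0) ∂P) * ENNReal.ofReal ((1 + Pu * σ * z)⁻¹))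
      atTop (𝓝 ((∫⁻ ω, expNeg (∑' k : ℕ, if (k : ℕ∞) < S.N ω then f (S.x k ω) else 0) ∂P) *
        ENNReal.ofReal ((1 + Pu * σ * z)⁻¹))) := by
    refine ENNReal.Tendsto.mul_const ?_ (Or.inr ENNReal.ofReal_ne_top)
    refine tendsto_lintegral_of_dominated_convergence (fun _ => 1) (fun n => ?_)
      (fun n => ae_of_all _ fun ω => ?_) (by simp) (ae_of_all _ fun ω => ?_)
    · refine Finset.measurable_fun_prod _ fun k _ => hem.comp ?_
      exact Measurable.ite
        (S.poisson.measurable_number (MeasurableSet.of_discrete (s := Set.Ioi (k : ℕ∞))))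
        (hfm.comp (S.poisson.measurable_point k)) measurable_const
    · exact Finset.prod_le_one' fun k _ => expNeg_le_one _
    · exact tendsto_expNeg_sum _
  simp_rw [hfin] at hL
  have := tendsto_nhds_unique hL hR
  simp_rw [hloop]
  rw [this]
  congr 1
  have : SigmaFinite (ENNReal.ofReal lam • (volume.restrict D) : Measure Plane) :=
    SMul.sigmaFinite (μ := volume.restrict D) lam.toNNReal
  rw [S.poisson.laplace_functional hfm, exponent, lintegral_smul_measure, smul_eq_mul]
  congr 1
  -- The logarithm in f cancels here, and what remains is the thinning of the density from λ to pλ.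
  have hind : ∀ y, 1 - expNeg (f y) =
      A.indicator (fun y => ENNReal.ofReal p * ENNReal.ofReal (1 - gainLaplace M ε α Pb z y)) y := by
    intro y
    by_cases hy : y ∈ A
    · have h2 := gainLaplace_le_one (M := M) (α := α) hε hPb hz y
      have h1 := gainLaplace_pos (M := M) (α := α) hε hPb hz y
      rw [hf, expNeg_logFactor hp hε hPb hz hy, Set.indicator_of_mem hy, ← ENNReal.ofReal_one,
        ← ENNReal.ofReal_sub _ (by nlinarith [hp.1, hp.2]), ← ENNReal.ofReal_mul hp.1]
      congr 1
      ring
    · rw [hf, logFactor, Set.indicator_of_notMem hy, Set.indicator_of_notMem hy]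
      simp
  simp_rw [hind]
  rw [lintegral_indicator hA, Measure.restrict_restrict hA, lintegral_const_mul, ← mul_assoc,
    ← ENNReal.ofReal_mul hlam.le, mul_comm lam p]
  have := measurable_gainLaplace M ε α Pb z
  fun_prop

end Network

/-- The integrand of the expectation of `ln (1 + SINR)`. -/
noncomputable def rateKernel (M : ℕ) (lam p σ : ℝ) (D : Set Plane) (ε α Pb Pu : ℝ) (A : Set Plane)
    (z : ℝ) : ℝ≥0∞ :=
  ENNReal.ofReal (Real.exp (-z) / (z * (1 + Pu * σ * z))) *
    (1 - expNeg (exponent M lam p D ε α Pb A z))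

/-! ### The average rate as an integral over the Laplace variable. -/

namespace Network

variable {Ω : Type*} [MeasurableSpace Ω] {P : Measure Ω} {M : ℕ}
  {lam p σ : ℝ} {D : Set Plane}

/-- True also where the power is infinite: `toReal` of ∞ and the `tsum` of a non-summable family are
both 0. This makes `sinr` measurable without exceptions. -/
lemma toReal_totalPower (S : Network P M lam p σ D) {ε α Pb : ℝ} (hε : 0 ≤ ε) (hPb : 0 ≤ Pb)
    (A : Set Plane) (ω : Ω) :
    (S.totalPower ε α Pb A ω).toReal = ∑' k, S.receivedPower ε α Pb A k ω := by
  rw [totalPower, ENNReal.tsum_toReal_eq fun _ => ENNReal.ofReal_ne_top]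
  exact tsum_congr fun k => ENNReal.toReal_ofReal (S.receivedPower_nonneg hε hPb A k ω)

lemma summable_receivedPower (S : Network P M lam p σ D) {ε α Pb : ℝ} (hε : 0 ≤ ε) (hPb : 0 ≤ Pb)
    {A : Set Plane} {ω : Ω} (h : S.totalPower ε α Pb A ω ≠ ∞) :
    Summable fun k => S.receivedPower ε α Pb A k ω := by
  refine (ENNReal.summable_toReal h).congr fun k => ?_
  exact ENNReal.toReal_ofReal (S.receivedPower_nonneg hε hPb A k ω)

lemma sinr_nonneg (S : Network P M lam p σ D) {ε α Pb Pu : ℝ} (hε : 0 ≤ ε) (hPb : 0 ≤ Pb)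
    (hPu : 0 ≤ Pu) (A : Set Plane) (ω : Ω) : 0 ≤ S.sinr ε α Pb Pu A ω :=
  div_nonneg (tsum_nonneg fun k => S.receivedPower_nonneg hε hPb A k ω) (by positivity)

lemma measurable_sinr (S : Network P M lam p σ D) {ε α Pb : ℝ} (Pu : ℝ) (hε : 0 ≤ ε)
    (hPb : 0 ≤ Pb) {A : Set Plane} (hA : MeasurableSet A) :
    Measurable (S.sinr ε α Pb Pu A) := by
  have h1 := (S.measurable_totalPower ε α Pb hA).ennreal_toReal
  simp_rw [S.toReal_totalPower hε hPb] at h1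
  have h2 := S.measurable_hLI
  exact h1.div (by fun_prop)

variable [IsProbabilityMeasure P]

/-- Tonelli needs no finiteness. For fixed z the kernel is a difference of two transforms, of V
alone and of X and V jointly. -/
lemma lintegral_logKernel (S : Network P M lam p σ D) (hlam : 0 < lam)
    (hp : p ∈ Set.Icc (0 : ℝ) 1) (hσ : 0 < σ) {ε α Pb Pu : ℝ} (hε : 0 ≤ ε) (hPb : 0 ≤ Pb)
    (hPu : 0 ≤ Pu) {A : Set Plane} (hA : MeasurableSet A) :
    ∫⁻ ω, (∫⁻ z in Set.Ioi (0 : ℝ),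
        logKernel (ENNReal.ofReal (Pu * ‖S.hLI ω‖ ^ 2)) (S.totalPower ε α Pb A ω) z) ∂P =
      ∫⁻ z in Set.Ioi (0 : ℝ), rateKernel M lam p σ D ε α Pb Pu A z := by
  have hX := S.measurable_totalPower ε α Pb hA
  have hL := S.measurable_hLI
  have hem := measurable_expNeg
  rw [lintegral_lintegral_swap]
  swap
  · have := measurable_logKernel.comp
      (f := fun q : Ω × ℝ => ((ENNReal.ofReal (Pu * ‖S.hLI q.1‖ ^ 2), S.totalPower ε α Pb A q.1), q.2))
      (by fun_prop)
    exact this.aemeasurable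
  refine setLIntegral_congr_fun measurableSet_Ioi fun z hz => ?_
  have hz : 0 < z := hz
  simp only [logKernel]
  rw [lintegral_const_mul _ (by fun_prop)]
  have h1 : ∀ ω, expNeg (ENNReal.ofReal z * ENNReal.ofReal (Pu * ‖S.hLI ω‖ ^ 2)) *
      (1 - expNeg (ENNReal.ofReal z * S.totalPower ε α Pb A ω)) =
      expNeg (ENNReal.ofReal z * ENNReal.ofReal (Pu * ‖S.hLI ω‖ ^ 2)) -
        expNeg (ENNReal.ofReal z * S.totalPower ε α Pb A ω) *
          expNeg (ENNReal.ofReal z * ENNReal.ofReal (Pu * ‖S.hLI ω‖ ^ 2)) := by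
    intro ω
    rw [ENNReal.mul_sub (fun _ _ => expNeg_ne_top _), mul_one,
      mul_comm (expNeg (_ * S.totalPower _ _ _ _ _))]
  have h2 := S.laplace_totalPower hlam hp hσ (α := α) hε hPb hPu hz.le hA
  have h3 : ∫⁻ ω, expNeg (ENNReal.ofReal z * ENNReal.ofReal (Pu * ‖S.hLI ω‖ ^ 2)) ∂P =
      ENNReal.ofReal ((1 + Pu * σ * z)⁻¹) := by
    have := S.lintegral_exp_neg_loop hσ (t := z * Pu) (by positivity)
    rw [show 1 + Pu * σ * z = 1 + z * Pu * σ by ring, ← this]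
    refine lintegral_congr fun ω => ?_
    rw [← ENNReal.ofReal_mul hz.le, expNeg_ofReal (by positivity), mul_assoc]
  simp_rw [h1]
  rw [lintegral_sub (by fun_prop), h2, h3, rateKernel]
  · have h4 : Real.exp (-z) / (z * (1 + Pu * σ * z)) = Real.exp (-z) / z * (1 + Pu * σ * z)⁻¹ := by
      field_simp
    rw [h4, ENNReal.ofReal_mul (by positivity), mul_assoc (ENNReal.ofReal _)]
    congr 1
    rw [ENNReal.mul_sub (fun _ _ => ENNReal.ofReal_ne_top), mul_one, mul_comm (expNeg _)]
  · rw [h2]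
    exact ENNReal.mul_ne_top (expNeg_ne_top _) ENNReal.ofReal_ne_top
  · exact ae_of_all _ fun ω => mul_le_of_le_one_left zero_le (expNeg_le_one _)

/-- A finite expectation makes the inner integral finite almost surely, which
`lintegral_logKernel_top` rules out where the power is infinite. -/
lemma totalPower_ne_top (S : Network P M lam p σ D) (hlam : 0 < lam)
    (hp : p ∈ Set.Icc (0 : ℝ) 1) (hσ : 0 < σ) {ε α Pb Pu : ℝ} (hε : 0 ≤ ε) (hPb : 0 ≤ Pb)
    (hPu : 0 ≤ Pu) {A : Set Plane} (hA : MeasurableSet A)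
    (hfin : ∫⁻ z in Set.Ioi (0 : ℝ), rateKernel M lam p σ D ε α Pb Pu A z ≠ ∞) :
    ∀ᵐ ω ∂P, S.totalPower ε α Pb A ω ≠ ∞ := by
  rw [← S.lintegral_logKernel hlam hp hσ hε hPb hPu hA] at hfin
  have hX := S.measurable_totalPower ε α Pb hA
  have hL := S.measurable_hLI
  have hm := measurable_logKernel.comp
      (f := fun q : Ω × ℝ => ((ENNReal.ofReal (Pu * ‖S.hLI q.1‖ ^ 2), S.totalPower ε α Pb A q.1), q.2))
      (by fun_prop)
  have := ae_lt_top (hm.lintegral_prod_right' (ν := volume.restrict (Set.Ioi (0 : ℝ)))) hfin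
  filter_upwards [this] with ω hω htop
  simp only [Function.comp_def, htop] at hω
  rw [lintegral_logKernel_top (by positivity)] at hω
  exact lt_irrefl _ hω

/-- The average rate as an integral of the Laplace transforms of the received power and of the loop
interference. -/
theorem lintegral_log_sinr (S : Network P M lam p σ D) (hlam : 0 < lam)
    (hp : p ∈ Set.Icc (0 : ℝ) 1) (hσ : 0 < σ) {ε α Pb Pu : ℝ} (hε : 0 ≤ ε) (hPb : 0 ≤ Pb)
    (hPu : 0 ≤ Pu) {A : Set Plane} (hA : MeasurableSet A)
    (hfin : ∫⁻ z in Set.Ioi (0 : ℝ), rateKernel M lam p σ D ε α Pb Pu A z ≠ ∞) :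
    ∫⁻ ω, ENNReal.ofReal (Real.log (1 + S.sinr ε α Pb Pu A ω)) ∂P =
      ∫⁻ z in Set.Ioi (0 : ℝ), rateKernel M lam p σ D ε α Pb Pu A z := by
  rw [← S.lintegral_logKernel hlam hp hσ hε hPb hPu hA]
  refine lintegral_congr_ae ?_
  filter_upwards [S.totalPower_ne_top hlam hp hσ hε hPb hPu hA hfin] with ω hω
  rw [sinr, ← S.toReal_totalPower hε hPb,
    ← lintegral_logKernel_ofReal (by positivity) ENNReal.toReal_nonneg, ENNReal.ofReal_toReal hω]

omit [IsProbabilityMeasure P] in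
lemma log_sinr_nonneg (S : Network P M lam p σ D) {ε α Pb Pu : ℝ} (hε : 0 ≤ ε) (hPb : 0 ≤ Pb)
    (hPu : 0 ≤ Pu) (A : Set Plane) (ω : Ω) : 0 ≤ Real.log (1 + S.sinr ε α Pb Pu A ω) :=
  Real.log_nonneg (by linarith [S.sinr_nonneg (α := α) hε hPb hPu A ω])

theorem integrable_log_sinr (S : Network P M lam p σ D) (hlam : 0 < lam)
    (hp : p ∈ Set.Icc (0 : ℝ) 1) (hσ : 0 < σ) {ε α Pb Pu : ℝ} (hε : 0 ≤ ε) (hPb : 0 ≤ Pb)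
    (hPu : 0 ≤ Pu) {A : Set Plane} (hA : MeasurableSet A)
    (hfin : ∫⁻ z in Set.Ioi (0 : ℝ), rateKernel M lam p σ D ε α Pb Pu A z ≠ ∞) :
    Integrable (fun ω => Real.log (1 + S.sinr ε α Pb Pu A ω)) P := by
  have hm := S.measurable_sinr (α := α) Pu hε hPb hA
  refine ⟨(Real.measurable_log.comp (hm.const_add 1)).aestronglyMeasurable, ?_⟩
  rw [hasFiniteIntegral_iff_ofReal (ae_of_all _ fun ω => S.log_sinr_nonneg hε hPb hPu A ω),
    S.lintegral_log_sinr hlam hp hσ hε hPb hPu hA hfin]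
  exact hfin.lt_top

theorem avgRate_eq (S : Network P M lam p σ D) (hlam : 0 < lam)
    (hp : p ∈ Set.Icc (0 : ℝ) 1) (hσ : 0 < σ) {ε α Pb Pu : ℝ} (hε : 0 ≤ ε) (hPb : 0 ≤ Pb)
    (hPu : 0 ≤ Pu) {A : Set Plane} (hA : MeasurableSet A)
    (hfin : ∫⁻ z in Set.Ioi (0 : ℝ), rateKernel M lam p σ D ε α Pb Pu A z ≠ ∞) :
    S.avgRate ε α Pb Pu A = (∫⁻ z in Set.Ioi (0 : ℝ), rateKernel M lam p σ D ε α Pb Pu A z).toReal := by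
  have hm := S.measurable_sinr (α := α) Pu hε hPb hA
  rw [avgRate, integral_eq_lintegral_of_nonneg_ae
    (ae_of_all _ fun ω => S.log_sinr_nonneg hε hPb hPu A ω)
    (Real.measurable_log.comp (hm.const_add 1)).aestronglyMeasurable,
    S.lintegral_log_sinr hlam hp hσ hε hPb hPu hA hfin]

omit [IsProbabilityMeasure P] in
/-- The average rate in growing balls tends to the average rate in the whole region. -/
theorem tendsto_avgRate (S : Network P M lam p σ D) {ε α Pb Pu : ℝ} (hε : 0 ≤ ε) (hPb : 0 ≤ Pb)
    (hPu : 0 ≤ Pu) (hX : ∀ᵐ ω ∂P, S.totalPower ε α Pb Set.univ ω ≠ ∞)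
    (hint : Integrable (fun ω => Real.log (1 + S.sinr ε α Pb Pu Set.univ ω)) P) :
    Tendsto (fun R : ℝ => S.avgRate ε α Pb Pu (Metric.ball 0 R)) atTop
      (𝓝 (S.avgRate ε α Pb Pu Set.univ)) := by
  refine tendsto_integral_filter_of_dominated_convergence _ (Eventually.of_forall fun R => ?_)
    (Eventually.of_forall fun R => ?_) hint ?_
  · have := S.measurable_sinr (α := α) Pu hε hPb (Metric.isOpen_ball (x := 0) (ε := R)).measurableSet
    exact (Real.measurable_log.comp (this.const_add 1)).aestronglyMeasurable
  · filter_upwards [hX] with ω hω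
    rw [Real.norm_of_nonneg (S.log_sinr_nonneg hε hPb hPu _ ω)]
    have h0 := S.sinr_nonneg (α := α) hε hPb hPu (Metric.ball 0 R) ω
    refine Real.log_le_log (by linarith) ?_
    unfold sinr
    refine add_le_add_right (div_le_div_of_nonneg_right ?_ (by positivity)) 1
    have hs := S.summable_receivedPower hε hPb hω
    have hle := fun k => S.receivedPower_mono (α := α) hε hPb (Set.subset_univ (Metric.ball 0 R)) k ω
    exact Summable.tsum_le_tsum hle
      (hs.of_nonneg_of_le (fun k => S.receivedPower_nonneg hε hPb _ k ω) hle) hs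
  · filter_upwards [hX] with ω hω
    have h0 := S.sinr_nonneg (α := α) hε hPb hPu Set.univ ω
    refine ((Real.continuousAt_log (by linarith)).tendsto).comp ?_
    refine tendsto_const_nhds.add (Tendsto.div_const ?_ _)
    refine tendsto_tsum_of_dominated_convergence (S.summable_receivedPower hε hPb hω)
      (fun k => ?_) (Eventually.of_forall fun R k => ?_)
    -- Each point lies in the ball once R exceeds its norm, so each term is eventually constant in
    -- R.
    · refine tendsto_const_nhds.congr' ?_
      filter_upwards [eventually_gt_atTop ‖S.x k ω‖] with R hR
      simp [receivedPower, hR]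
    · rw [Real.norm_of_nonneg (S.receivedPower_nonneg hε hPb _ k ω)]
      exact S.receivedPower_mono hε hPb (Set.subset_univ _) k ω

end Network

/-! ### The exponent of the singular path loss -/

/-- A non-integrable function would have integral 0 by default, but the Gamma value is positive. -/
lemma integrableOn_rpow_mul_exp_neg_mul {a r : ℝ} (ha : 0 < a) (hr : 0 < r) :
    IntegrableOn (fun t : ℝ => t ^ (a - 1) * Real.exp (-(r * t))) (Set.Ioi 0) := by
  by_contra h
  have h1 := Real.integral_rpow_mul_exp_neg_mul_Ioi ha hr
  rw [integral_undef h] at h1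
  have : 0 < (1 / r) ^ a * Real.Gamma a := mul_pos (by positivity) (Real.Gamma_pos_of_pos ha)
  exact this.ne h1

lemma lintegral_rpow_mul_exp_neg_mul {a r : ℝ} (ha : 0 < a) (hr : 0 < r) :
    ∫⁻ t in Set.Ioi (0 : ℝ), ENNReal.ofReal (t ^ (a - 1) * Real.exp (-(r * t))) =
      ENNReal.ofReal ((1 / r) ^ a * Real.Gamma a) := by
  rw [← Real.integral_rpow_mul_exp_neg_mul_Ioi ha hr, ofReal_integral_eq_lintegral_ofReal]
  · exact integrableOn_rpow_mul_exp_neg_mul ha hr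
  · refine (ae_restrict_iff' measurableSet_Ioi).2 (ae_of_all _ fun t ht => ?_)
    have ht : 0 < t := ht
    simp only [Pi.zero_apply]
    positivity

/-- Write (1+s)^{-(M+1)} as a Gamma integral in u and swap. The integral in s gives Γ(1-δ) u^{δ-1},
and the remaining one in u gives Γ(M+δ). -/
lemma lintegral_beta (M : ℕ) {δ : ℝ} (h0 : 0 < δ) (h1 : δ < 1) :
    ∫⁻ s in Set.Ioi (0 : ℝ), ENNReal.ofReal (s ^ (-δ) * ((1 + s) ^ (M + 1))⁻¹) =
      ENNReal.ofReal (Real.Gamma (1 - δ) * Real.Gamma (M + δ) / Real.Gamma (M + 1)) := by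
  have hG : 0 < Real.Gamma (M + 1) := Real.Gamma_pos_of_pos (by positivity)
  have e1 : ∀ s ∈ Set.Ioi (0 : ℝ), ENNReal.ofReal (s ^ (-δ) * ((1 + s) ^ (M + 1))⁻¹) =
      ENNReal.ofReal (Real.Gamma (M + 1))⁻¹ * ∫⁻ u in Set.Ioi (0 : ℝ), ENNReal.ofReal (s ^ (-δ)) *
        ENNReal.ofReal (u ^ ((M + 1 : ℝ) - 1) * Real.exp (-((1 + s) * u))) := by
    intro s hs
    have hs : 0 < s := hs
    rw [lintegral_const_mul _ (by fun_prop), lintegral_rpow_mul_exp_neg_mul (by positivity)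
      (by positivity), ← ENNReal.ofReal_mul (by positivity), ← ENNReal.ofReal_mul (by positivity)]
    congr 1
    rw [one_div, Real.inv_rpow (by positivity), ← Real.rpow_natCast]
    push_cast
    field_simp
  rw [setLIntegral_congr_fun measurableSet_Ioi e1, lintegral_const_mul _ (by fun_prop),
    lintegral_lintegral_swap (by fun_prop)]
  have e2 : ∀ u ∈ Set.Ioi (0 : ℝ), ∫⁻ s in Set.Ioi (0 : ℝ), ENNReal.ofReal (s ^ (-δ)) *
        ENNReal.ofReal (u ^ ((M + 1 : ℝ) - 1) * Real.exp (-((1 + s) * u))) =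
      ENNReal.ofReal (Real.Gamma (1 - δ)) *
        ENNReal.ofReal (u ^ ((M + δ : ℝ) - 1) * Real.exp (-(1 * u))) := by
    intro u hu
    have hu : 0 < u := hu
    have e3 : ∀ s ∈ Set.Ioi (0 : ℝ), ENNReal.ofReal (s ^ (-δ)) *
        ENNReal.ofReal (u ^ ((M + 1 : ℝ) - 1) * Real.exp (-((1 + s) * u))) =
        ENNReal.ofReal (u ^ (M : ℝ) * Real.exp (-u)) *
          ENNReal.ofReal (s ^ ((1 - δ) - 1) * Real.exp (-(u * s))) := by
      intro s hs
      have hs : 0 < s := hs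
      rw [← ENNReal.ofReal_mul (by positivity), ← ENNReal.ofReal_mul (by positivity)]
      congr 1
      rw [show -((1 + s) * u) = -u + -(u * s) by ring, Real.exp_add,
        show (1 - δ) - 1 = -δ by ring, show (M + 1 : ℝ) - 1 = M by ring]
      ring
    have hg1 : 0 < Real.Gamma (1 - δ) := Real.Gamma_pos_of_pos (by linarith)
    rw [setLIntegral_congr_fun measurableSet_Ioi e3, lintegral_const_mul _ (by fun_prop),
      lintegral_rpow_mul_exp_neg_mul (by linarith) hu, ← ENNReal.ofReal_mul (by positivity),
      ← ENNReal.ofReal_mul hg1.le]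
    congr 1
    rw [one_div, Real.inv_rpow hu.le, ← Real.rpow_neg hu.le,
      show (M + δ : ℝ) - 1 = M + -(1 - δ) by ring, Real.rpow_add hu, one_mul]
    ring
  have hg1 : 0 < Real.Gamma (1 - δ) := Real.Gamma_pos_of_pos (by linarith)
  rw [setLIntegral_congr_fun measurableSet_Ioi e2, lintegral_const_mul _ (by fun_prop),
    lintegral_rpow_mul_exp_neg_mul (by positivity) one_pos, ← ENNReal.ofReal_mul hg1.le,
    ← ENNReal.ofReal_mul (by positivity)]
  congr 1
  rw [div_one, Real.one_rpow]
  field_simp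

/-- Fundamental theorem of calculus on (0, t), written on the half-line with a cutoff so that it can
be swapped with the radial integral. -/
lemma ofReal_one_sub_inv_pow (M : ℕ) {t : ℝ} (ht : 0 ≤ t) :
    ENNReal.ofReal (1 - ((1 + t) ^ M)⁻¹) =
      ∫⁻ s in Set.Ioi (0 : ℝ), if s < t then ENNReal.ofReal (M * ((1 + s) ^ (M + 1))⁻¹) else 0 := by
  have hd : ∀ s ∈ Set.uIcc 0 t,
      HasDerivAt (fun s : ℝ => -((1 + s) ^ M)⁻¹) (M * ((1 + s) ^ (M + 1))⁻¹) s := by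
    intro s hs
    rw [Set.uIcc_of_le ht] at hs
    have hs : 0 < 1 + s := by linarith [hs.1]
    have := ((((hasDerivAt_id s).const_add 1).pow M).inv (pow_pos hs M).ne').neg
    convert! this using 1
    rcases M with _ | m
    · simp
    · simp only [id, Nat.add_sub_cancel]
      field_simp
      simp only [Pi.pow_apply]
      field_simp
      ring
  have hc : ContinuousOn (fun s : ℝ => (M : ℝ) * ((1 + s) ^ (M + 1))⁻¹) (Set.uIcc 0 t) := by
    rw [Set.uIcc_of_le ht]
    refine continuousOn_const.mul (ContinuousOn.inv₀ (by fun_prop) fun s hs => ?_)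
    have : 0 < 1 + s := by linarith [hs.1]
    positivity
  have hi : IntervalIntegrable (fun s : ℝ => (M : ℝ) * ((1 + s) ^ (M + 1))⁻¹) volume 0 t :=
    hc.intervalIntegrable
  have h1 := intervalIntegral.integral_eq_sub_of_hasDerivAt hd hi
  rw [intervalIntegral.integral_of_le ht] at h1
  have h2 : (fun s : ℝ => if s < t then ENNReal.ofReal (M * ((1 + s) ^ (M + 1))⁻¹) else 0) =
      (Set.Iio t).indicator fun s => ENNReal.ofReal (M * ((1 + s) ^ (M + 1))⁻¹) := by
    ext s; simp [Set.indicator_apply]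
  rw [h2, lintegral_indicator measurableSet_Iio, Measure.restrict_restrict measurableSet_Iio,
    Set.inter_comm, Set.Ioi_inter_Iio, restrict_Ioo_eq_restrict_Ioc,
    ← ofReal_integral_eq_lintegral_ofReal hi.1, h1]
  · congr 1
    simp
    ring
  · refine (ae_restrict_iff' measurableSet_Ioc).2 (ae_of_all _ fun s hs => ?_)
    have : 0 < 1 + s := by linarith [hs.1]
    simp only [Pi.zero_apply]
    positivity

/-- The condition says r < b with b = (c/s)^{1/α}, and ∫_0^b r dr = b²/2. -/
lemma lintegral_radius {α c s : ℝ} (hα : 0 < α) (hc : 0 < c) (hs : 0 < s) :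
    ∫⁻ r in Set.Ioi (0 : ℝ), (if s < c / r ^ α then ENNReal.ofReal r else 0) =
      ENNReal.ofReal ((c / s) ^ (2 / α) / 2) := by
  set b := (c / s) ^ (1 / α) with hb
  have hb0 : 0 < b := by positivity
  have h1 : ∀ r ∈ Set.Ioi (0 : ℝ), (if s < c / r ^ α then ENNReal.ofReal r else 0) =
      (Set.Iio b).indicator (fun r => ENNReal.ofReal r) r := by
    intro r hr
    have hr : 0 < r := hr
    have : s < c / r ^ α ↔ r < b := by
      rw [lt_div_iff₀ (by positivity), mul_comm, ← lt_div_iff₀ hs, hb,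
        ← Real.rpow_lt_rpow_iff (z := α) hr.le (by positivity) hα, ← Real.rpow_mul (by positivity),
        one_div_mul_cancel hα.ne', Real.rpow_one]
    simp [Set.indicator_apply, this]
  rw [setLIntegral_congr_fun measurableSet_Ioi h1, lintegral_indicator measurableSet_Iio,
    Measure.restrict_restrict measurableSet_Iio, Set.inter_comm, Set.Ioi_inter_Iio,
    restrict_Ioo_eq_restrict_Ioc, ← ofReal_integral_eq_lintegral_ofReal,
    ← intervalIntegral.integral_of_le hb0.le, integral_id]
  · congr 1
    rw [hb, ← Real.rpow_natCast (_ ^ _) 2, ← Real.rpow_mul (by positivity)]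
    norm_num
    congr 1
    ring
  · exact (continuous_id.intervalIntegrable 0 b).1
  · exact (ae_restrict_iff' measurableSet_Ioc).2 (ae_of_all _ fun s hs => hs.1.le)

/-- After the layer-cake formula the radial integral gives s^{-2/α}, leaving `lintegral_beta` with δ
= 2/α; its condition δ < 1 is α > 2. -/
lemma lintegral_exponentIntegrand_zero {M : ℕ} (hM : 1 ≤ M) {α Pb z : ℝ} (hα : 2 < α)
    (hPb : 0 < Pb) (hz : 0 < z) :
    ∫⁻ r in Set.Ioi (0 : ℝ), ENNReal.ofReal (exponentIntegrand M 0 α Pb z r) =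
      ENNReal.ofReal ((z * Pb) ^ (2 / α) / 2 *
        (Real.Gamma (1 - 2 / α) * Real.Gamma (M + 2 / α) / Real.Gamma M)) := by
  have hα0 : 0 < α := by linarith
  have hδ0 : 0 < 2 / α := by positivity
  have hδ1 : 2 / α < 1 := by rw [div_lt_one hα0]; exact hα
  set c := z * Pb with hc
  have hc0 : 0 < c := by positivity
  have h1 : ∀ r ∈ Set.Ioi (0 : ℝ), ENNReal.ofReal (exponentIntegrand M 0 α Pb z r) =
      ∫⁻ s in Set.Ioi (0 : ℝ), ENNReal.ofReal (M * ((1 + s) ^ (M + 1))⁻¹) *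
        (if s < c / r ^ α then ENNReal.ofReal r else 0) := by
    intro r hr
    have hr : 0 < r := hr
    rw [exponentIntegrand, zero_add, ← hc, ENNReal.ofReal_mul' hr.le,
      ofReal_one_sub_inv_pow M (by positivity), ← lintegral_mul_const']
    · refine lintegral_congr fun s => ?_
      split_ifs <;> simp
    · exact ENNReal.ofReal_ne_top
  rw [setLIntegral_congr_fun measurableSet_Ioi h1, lintegral_lintegral_swap]
  swap
  · refine Measurable.aemeasurable (Measurable.mul (by fun_prop) (Measurable.ite ?_ (by fun_prop)
      measurable_const))
    exact measurableSet_lt (by fun_prop) (by fun_prop)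
  have h2 : ∀ s ∈ Set.Ioi (0 : ℝ), ∫⁻ r in Set.Ioi (0 : ℝ),
      ENNReal.ofReal (M * ((1 + s) ^ (M + 1))⁻¹) *
        (if s < c / r ^ α then ENNReal.ofReal r else 0) =
      ENNReal.ofReal (c ^ (2 / α) / 2 * M) *
        ENNReal.ofReal (s ^ (-(2 / α)) * ((1 + s) ^ (M + 1))⁻¹) := by
    intro s hs
    have hs : 0 < s := hs
    rw [lintegral_const_mul' _ _ ENNReal.ofReal_ne_top, lintegral_radius hα0 hc0 hs,
      ← ENNReal.ofReal_mul (by positivity), ← ENNReal.ofReal_mul (by positivity)]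
    congr 1
    rw [Real.div_rpow hc0.le hs.le, Real.rpow_neg hs.le]
    field_simp
  rw [setLIntegral_congr_fun measurableSet_Ioi h2, lintegral_const_mul _ (by fun_prop),
    lintegral_beta M hδ0 hδ1, ← ENNReal.ofReal_mul (by positivity)]
  congr 1
  have hM0 : (0 : ℝ) < M := by exact_mod_cast hM
  have hG : 0 < Real.Gamma M := Real.Gamma_pos_of_pos hM0
  rw [Real.Gamma_add_one hM0.ne']
  field_simp

lemma exponentIntegrand_nonneg {M : ℕ} {ε α Pb z r : ℝ} (hε : 0 ≤ ε) (hPb : 0 ≤ Pb) (hz : 0 ≤ z)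
    (hr : 0 ≤ r) : 0 ≤ exponentIntegrand M ε α Pb z r := by
  refine mul_nonneg (sub_nonneg.2 (inv_le_one_of_one_le₀ (one_le_pow₀ ?_))) hr
  have : 0 ≤ z * Pb / (ε + r ^ α) := by positivity
  linarith

/-- The singular path loss dominates every other one; this supplies integrability for all ε and the
dominating function for ε → 0. -/
lemma exponentIntegrand_le {M : ℕ} {ε α Pb z r : ℝ} (hε : 0 ≤ ε) (hPb : 0 ≤ Pb) (hz : 0 ≤ z)
    (hr : 0 < r) : exponentIntegrand M ε α Pb z r ≤ exponentIntegrand M 0 α Pb z r := by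
  unfold exponentIntegrand
  gcongr

lemma measurable_exponentIntegrand (M : ℕ) (ε α Pb : ℝ) :
    Measurable fun q : ℝ × ℝ => exponentIntegrand M ε α Pb q.1 q.2 := by
  unfold exponentIntegrand
  fun_prop

lemma integrableOn_exponentIntegrand {M : ℕ} (hM : 1 ≤ M) {ε α Pb z : ℝ} (hε : 0 ≤ ε)
    (hα : 2 < α) (hPb : 0 < Pb) (hz : 0 < z) :
    IntegrableOn (exponentIntegrand M ε α Pb z) (Set.Ioi 0) := by
  have hm : Measurable (exponentIntegrand M ε α Pb z) :=
    (measurable_exponentIntegrand M ε α Pb).comp measurable_prodMk_left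
  refine ⟨hm.aestronglyMeasurable, ?_⟩
  rw [hasFiniteIntegral_iff_ofReal]
  · refine lt_of_le_of_lt (setLIntegral_mono' measurableSet_Ioi fun r hr => ENNReal.ofReal_le_ofReal
      (exponentIntegrand_le hε hPb.le hz.le hr)) ?_
    rw [lintegral_exponentIntegrand_zero hM hα hPb hz]
    exact ENNReal.ofReal_lt_top
  · exact (ae_restrict_iff' measurableSet_Ioi).2 (ae_of_all _ fun r hr =>
      exponentIntegrand_nonneg hε hPb.le hz.le (le_of_lt hr))

lemma integral_exponentIntegrand_zero {M : ℕ} (hM : 1 ≤ M) {α Pb z : ℝ} (hα : 2 < α)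
    (hPb : 0 < Pb) (hz : 0 < z) :
    ∫ r in Set.Ioi (0 : ℝ), exponentIntegrand M 0 α Pb z r = (z * Pb) ^ (2 / α) / 2 *
        (Real.Gamma (1 - 2 / α) * Real.Gamma (M + 2 / α) / Real.Gamma M) := by
  have hδ1 : 2 / α < 1 := by rw [div_lt_one (by linarith)]; exact hα
  have hM0 : (0 : ℝ) < M := by exact_mod_cast hM
  have h1 : 0 < Real.Gamma (1 - 2 / α) := Real.Gamma_pos_of_pos (by linarith)
  have h2 : 0 < Real.Gamma (M + 2 / α) := Real.Gamma_pos_of_pos (by positivity)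
  have h3 : 0 < Real.Gamma M := Real.Gamma_pos_of_pos hM0
  rw [integral_eq_lintegral_of_nonneg_ae, lintegral_exponentIntegrand_zero hM hα hPb hz,
    ENNReal.toReal_ofReal (by positivity)]
  · exact (ae_restrict_iff' measurableSet_Ioi).2 (ae_of_all _ fun r hr =>
      exponentIntegrand_nonneg le_rfl hPb.le hz.le (le_of_lt hr))
  · exact (integrableOn_exponentIntegrand hM le_rfl hα hPb hz).aestronglyMeasurable

/-- Γ(1-δ) = -δ Γ(-δ) brings in `gammaConst` and accounts for the minus sign. -/
lemma exponent_zero_eq {M : ℕ} (hM : 1 ≤ M) (lam p : ℝ) {α Pb z : ℝ} (hα : 2 < α)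
    (hPb : 0 < Pb) (hz : 0 < z) :
    2 * Real.pi * p * lam * ∫ r in Set.Ioi (0 : ℝ), exponentIntegrand M 0 α Pb z r =
      -(gammaConst M lam p (2 / α) * Pb ^ (2 / α)) * z ^ (2 / α) := by
  have hδ0 : 0 < 2 / α := by positivity
  have h := Real.Gamma_add_one (neg_ne_zero.2 hδ0.ne')
  rw [integral_exponentIntegrand_zero hM hα hPb hz, gammaConst, Real.mul_rpow hz.le hPb.le,
    show 1 - 2 / α = -(2 / α) + 1 by ring, h]
  ring

/-- Minus this number is the exponent at z = 1, an integral of a nonnegative function. -/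
lemma gammaConst_mul_nonpos {M : ℕ} (hM : 1 ≤ M) {lam p : ℝ} (hlam : 0 < lam) (hp : 0 ≤ p)
    {α Pb : ℝ} (hα : 2 < α) (hPb : 0 < Pb) :
    gammaConst M lam p (2 / α) * Pb ^ (2 / α) ≤ 0 := by
  have h := exponent_zero_eq hM lam p hα hPb one_pos
  rw [Real.one_rpow, mul_one] at h
  have : 0 ≤ 2 * Real.pi * p * lam * ∫ r in Set.Ioi (0 : ℝ), exponentIntegrand M 0 α Pb 1 r := by
    have := Real.pi_pos
    refine mul_nonneg (by positivity) (setIntegral_nonneg measurableSet_Ioi fun r hr => ?_)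
    exact exponentIntegrand_nonneg le_rfl hPb.le zero_le_one (le_of_lt hr)
  linarith

/-! ### The integrand of the bound -/

lemma boundIntegrand_nonneg {M : ℕ} {lam p σ ε α Pb Pu z : ℝ} (hlam : 0 ≤ lam) (hp : 0 ≤ p)
    (hσ : 0 ≤ σ) (hε : 0 ≤ ε) (hPb : 0 ≤ Pb) (hPu : 0 ≤ Pu) (hz : 0 < z) :
    0 ≤ boundIntegrand M lam p σ ε α Pb Pu z := by
  have := Real.pi_pos
  refine mul_nonneg (sub_nonneg.2 (Real.exp_le_one_iff.2 (neg_nonpos.2 (mul_nonneg (by positivity)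
    (setIntegral_nonneg measurableSet_Ioi fun r hr => ?_))))) (by positivity)
  exact exponentIntegrand_nonneg hε hPb hz.le (le_of_lt hr)

lemma boundIntegrand_le {M : ℕ} (hM : 1 ≤ M) {lam p σ ε α Pb Pu z : ℝ} (hlam : 0 ≤ lam) (hp : 0 ≤ p)
    (hσ : 0 ≤ σ) (hε : 0 ≤ ε) (hα : 2 < α) (hPb : 0 < Pb) (hPu : 0 ≤ Pu) (hz : 0 < z) :
    boundIntegrand M lam p σ ε α Pb Pu z ≤ boundIntegrand M lam p σ 0 α Pb Pu z := by
  have := Real.pi_pos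
  unfold boundIntegrand
  refine mul_le_mul_of_nonneg_right (sub_le_sub_left (Real.exp_le_exp.2 (neg_le_neg
    (mul_le_mul_of_nonneg_left (setIntegral_mono_on
      (integrableOn_exponentIntegrand hM hε hα hPb hz)
      (integrableOn_exponentIntegrand hM le_rfl hα hPb hz) measurableSet_Ioi
      fun r hr => exponentIntegrand_le hε hPb.le hz.le hr) (by positivity)))) _) (by positivity)

lemma measurable_boundIntegrand (M : ℕ) (lam p σ ε α Pb Pu : ℝ) :
    Measurable (boundIntegrand M lam p σ ε α Pb Pu) := by
  have h1 : Measurable fun z => ∫ r in Set.Ioi (0 : ℝ), exponentIntegrand M ε α Pb z r :=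
    ((measurable_exponentIntegrand M ε α Pb).stronglyMeasurable.integral_prod_right').measurable
  unfold boundIntegrand
  fun_prop

lemma boundIntegrand_zero_eq {M : ℕ} (hM : 1 ≤ M) (lam p σ : ℝ) {α Pb : ℝ} (Pu : ℝ) (hα : 2 < α)
    (hPb : 0 < Pb) {z : ℝ} (hz : 0 < z) :
    boundIntegrand M lam p σ 0 α Pb Pu z =
      (1 - Real.exp (gammaConst M lam p (2 / α) * Pb ^ (2 / α) * z ^ (2 / α))) *
        (Real.exp (-z) / (z * (1 + Pu * σ * z))) := by
  rw [boundIntegrand, exponent_zero_eq hM lam p hα hPb hz]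
  congr 3
  ring

/-- The estimate 1 - e^{c z^δ} ≤ -c z^δ tames the factor 1/z at the origin and leaves a Gamma
integrand z^{δ-1} e^{-z}. -/
lemma integrableOn_boundIntegrand_zero {M : ℕ} (hM : 1 ≤ M) {lam p σ α Pb Pu : ℝ} (hlam : 0 < lam)
    (hp : 0 ≤ p) (hσ : 0 ≤ σ) (hα : 2 < α) (hPb : 0 < Pb) (hPu : 0 ≤ Pu) :
    IntegrableOn (boundIntegrand M lam p σ 0 α Pb Pu) (Set.Ioi 0) := by
  have hδ0 : 0 < 2 / α := by positivity
  set c := gammaConst M lam p (2 / α) * Pb ^ (2 / α) with hc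
  have hc0 : c ≤ 0 := gammaConst_mul_nonpos hM hlam hp hα hPb
  have hdom := (integrableOn_rpow_mul_exp_neg_mul hδ0 one_pos).const_mul (-c)
  refine hdom.mono' (measurable_boundIntegrand M lam p σ 0 α Pb Pu).aestronglyMeasurable
    ((ae_restrict_iff' measurableSet_Ioi).2 (ae_of_all _ fun z hz => ?_))
  have hz : 0 < z := hz
  rw [Real.norm_of_nonneg (boundIntegrand_nonneg hlam.le hp hσ le_rfl hPb.le hPu hz),
    boundIntegrand_zero_eq hM lam p σ Pu hα hPb hz, ← hc]
  have h1 : 1 - Real.exp (c * z ^ (2 / α)) ≤ -c * z ^ (2 / α) := by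
    have := Real.add_one_le_exp (c * z ^ (2 / α))
    linarith
  have h2 : Real.exp (-z) / (z * (1 + Pu * σ * z)) ≤ Real.exp (-z) / z := by
    refine div_le_div_of_nonneg_left (Real.exp_pos _).le hz (le_mul_of_one_le_right hz.le ?_)
    have : 0 ≤ Pu * σ * z := by positivity
    linarith
  have h3 : 0 ≤ -c * z ^ (2 / α) := mul_nonneg (by linarith) (by positivity)
  calc _ ≤ -c * z ^ (2 / α) * (Real.exp (-z) / z) := mul_le_mul h1 h2 (by positivity) h3
    _ = -c * (z ^ (2 / α - 1) * Real.exp (-(1 * z))) := by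
      rw [Real.rpow_sub_one hz.ne', one_mul]
      ring

lemma integrableOn_boundIntegrand {M : ℕ} (hM : 1 ≤ M) {lam p σ ε α Pb Pu : ℝ} (hlam : 0 < lam)
    (hp : 0 ≤ p) (hσ : 0 ≤ σ) (hε : 0 ≤ ε) (hα : 2 < α) (hPb : 0 < Pb) (hPu : 0 ≤ Pu) :
    IntegrableOn (boundIntegrand M lam p σ ε α Pb Pu) (Set.Ioi 0) := by
  refine (integrableOn_boundIntegrand_zero (Pu := Pu) hM hlam hp hσ hα hPb hPu).mono'
    (measurable_boundIntegrand M lam p σ ε α Pb Pu).aestronglyMeasurable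
    ((ae_restrict_iff' measurableSet_Ioi).2 (ae_of_all _ fun z hz => ?_))
  rw [Real.norm_of_nonneg (boundIntegrand_nonneg hlam.le hp hσ hε hPb.le hPu hz)]
  exact boundIntegrand_le hM hlam.le hp hσ hε hα hPb hPu hz

/-- The bound is continuous in `ε` at `ε = 0`. -/
theorem tendsto_rateBound {M : ℕ} (hM : 1 ≤ M) {lam p σ α Pb Pu : ℝ} (hlam : 0 < lam)
    (hp : 0 ≤ p) (hσ : 0 ≤ σ) (hα : 2 < α) (hPb : 0 < Pb) (hPu : 0 ≤ Pu) :
    Tendsto (fun ε : ℝ => rateBound M lam p σ ε α Pb Pu) (𝓝[>] 0)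
      (𝓝 (rateBound M lam p σ 0 α Pb Pu)) := by
  have hev : ∀ᶠ ε : ℝ in 𝓝[>] 0, 0 < ε := eventually_mem_nhdsWithin
  refine tendsto_integral_filter_of_dominated_convergence _
    (Eventually.of_forall fun ε => (measurable_boundIntegrand M lam p σ ε α Pb Pu).aestronglyMeasurable)
    ?_ (integrableOn_boundIntegrand_zero hM hlam hp hσ hα hPb hPu) ?_
  · filter_upwards [hev] with ε hε
    refine (ae_restrict_iff' measurableSet_Ioi).2 (ae_of_all _ fun z hz => ?_)
    rw [Real.norm_of_nonneg (boundIntegrand_nonneg hlam.le hp hσ hε.le hPb.le hPu hz)]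
    exact boundIntegrand_le hM hlam.le hp hσ hε.le hα hPb hPu hz
  · refine (ae_restrict_iff' measurableSet_Ioi).2 (ae_of_all _ fun z hz => ?_)
    have hz : 0 < z := hz
    refine Tendsto.mul_const _ (tendsto_const_nhds.sub ((Real.continuous_exp.tendsto _).comp
      (Tendsto.neg (Tendsto.const_mul _ ?_))))
    -- A second dominated convergence, now in r inside the exponent, again with ε = 0 as the
    -- dominating case.
    refine tendsto_integral_filter_of_dominated_convergence _ (Eventually.of_forall fun ε =>
      ((measurable_exponentIntegrand M ε α Pb).comp measurable_prodMk_left).aestronglyMeasurable)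
      ?_ (integrableOn_exponentIntegrand hM le_rfl hα hPb hz) ?_
    · filter_upwards [hev] with ε hε
      refine (ae_restrict_iff' measurableSet_Ioi).2 (ae_of_all _ fun r hr => ?_)
      rw [Real.norm_of_nonneg (exponentIntegrand_nonneg hε.le hPb.le hz.le (le_of_lt hr))]
      exact exponentIntegrand_le hε.le hPb.le hz.le hr
    · refine (ae_restrict_iff' measurableSet_Ioi).2 (ae_of_all _ fun r hr => ?_)
      have hr : 0 < r := hr
      have hcont : ContinuousAt (fun ε : ℝ => exponentIntegrand M ε α Pb z r) 0 := by
        unfold exponentIntegrand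
        have h1 : (0 : ℝ) + r ^ α ≠ 0 := by positivity
        have h2 : (1 + z * Pb / (0 + r ^ α)) ^ M ≠ 0 := by positivity
        exact ((continuousAt_const.sub (((continuousAt_const.add (continuousAt_const.div
          (continuousAt_id.add continuousAt_const) h1)).pow M).inv₀ h2)).mul continuousAt_const)
      exact hcont.tendsto.mono_left nhdsWithin_le_nhds

/-! ### The exponent in polar coordinates -/

/-- Polar coordinates: the factor 2π is the dimension 2 times the area π of the unit disc. -/
lemma exponent_univ {M : ℕ} (hM : 1 ≤ M) {lam p ε α Pb z : ℝ} (hlam : 0 ≤ lam) (hp : 0 ≤ p)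
    (hε : 0 ≤ ε) (hα : 2 < α) (hPb : 0 < Pb) (hz : 0 < z) :
    exponent M lam p Set.univ ε α Pb Set.univ z = ENNReal.ofReal
      (2 * Real.pi * p * lam * ∫ r in Set.Ioi (0 : ℝ), exponentIntegrand M ε α Pb z r) := by
  set f : ℝ → ℝ := fun r => 1 - ((1 + z * (Pb * (1 / (ε + r ^ α)))) ^ M)⁻¹ with hf
  have hfr : ∀ r : ℝ, r ^ (Module.finrank ℝ Plane - 1) • f r = exponentIntegrand M ε α Pb z r := by
    intro r
    simp only [exponentIntegrand, hf, finrank_euclideanSpace_fin, mul_one_div, mul_div_assoc,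
      smul_eq_mul]
    ring
  have hint : Integrable (fun y : Plane => f ‖y‖) := by
    rw [integrable_fun_norm_addHaar volume (f := f)]
    simp_rw [hfr]
    exact integrableOn_exponentIntegrand hM hε hα hPb hz
  have hval := integral_fun_norm_addHaar (volume : Measure Plane) f
  simp_rw [hfr] at hval
  have hball : (volume : Measure Plane).real (Metric.ball 0 1) = Real.pi := by
    rw [Measure.real, EuclideanSpace.volume_ball_fin_two]
    simp [Real.pi_pos.le]
  rw [hball, finrank_euclideanSpace_fin] at hval
  rw [exponent, Set.univ_inter, Measure.restrict_univ]
  have hg : ∀ y : Plane, 1 - gainLaplace M ε α Pb z y = f ‖y‖ := fun y => rfl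
  simp_rw [hg]
  rw [← ofReal_integral_eq_lintegral_ofReal hint, hval, ← ENNReal.ofReal_mul (by positivity)]
  · congr 1
    simp only [nsmul_eq_mul, smul_eq_mul]
    push_cast
    ring
  · refine ae_of_all _ fun y => ?_
    simp only [Pi.zero_apply]
    rw [← hg]
    exact sub_nonneg.2 (gainLaplace_le_one hε hPb.le hz.le y)

/-- This comparison with the whole plane is the source of the upper bound for every region and
radius. -/
lemma exponent_mono {M : ℕ} {lam p ε α Pb z : ℝ} (D A : Set Plane) :
    exponent M lam p D ε α Pb A z ≤ exponent M lam p Set.univ ε α Pb Set.univ z := by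
  unfold exponent
  gcongr
  · exact Set.subset_univ _
  · exact Set.subset_univ _

lemma rateKernel_univ {M : ℕ} (hM : 1 ≤ M) {lam p σ ε α Pb Pu z : ℝ} (hlam : 0 ≤ lam) (hp : 0 ≤ p)
    (hσ : 0 ≤ σ) (hε : 0 ≤ ε) (hα : 2 < α) (hPb : 0 < Pb) (hPu : 0 ≤ Pu) (hz : 0 < z) :
    rateKernel M lam p σ Set.univ ε α Pb Pu Set.univ z =
      ENNReal.ofReal (boundIntegrand M lam p σ ε α Pb Pu z) := by
  have := Real.pi_pos
  rw [rateKernel, exponent_univ hM hlam hp hε hα hPb hz, one_sub_expNeg_ofReal,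
    ← ENNReal.ofReal_mul (by positivity), mul_comm, boundIntegrand]
  refine mul_nonneg (by positivity) (setIntegral_nonneg measurableSet_Ioi fun r hr => ?_)
  exact exponentIntegrand_nonneg hε hPb.le hz.le (le_of_lt hr)

lemma rateKernel_mono {M : ℕ} {lam p σ ε α Pb Pu z : ℝ} (D A : Set Plane) :
    rateKernel M lam p σ D ε α Pb Pu A z ≤ rateKernel M lam p σ Set.univ ε α Pb Pu Set.univ z := by
  unfold rateKernel
  gcongr
  exact expNeg_antitone (exponent_mono D A)

lemma lintegral_rateKernel_univ {M : ℕ} (hM : 1 ≤ M) {lam p σ ε α Pb Pu : ℝ} (hlam : 0 < lam)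
    (hp : 0 ≤ p) (hσ : 0 ≤ σ) (hε : 0 ≤ ε) (hα : 2 < α) (hPb : 0 < Pb) (hPu : 0 ≤ Pu) :
    ∫⁻ z in Set.Ioi (0 : ℝ), rateKernel M lam p σ Set.univ ε α Pb Pu Set.univ z =
      ENNReal.ofReal (rateBound M lam p σ ε α Pb Pu) := by
  rw [rateBound, ofReal_integral_eq_lintegral_ofReal
    (integrableOn_boundIntegrand hM hlam hp hσ hε hα hPb hPu)]
  · exact setLIntegral_congr_fun measurableSet_Ioi fun z hz =>
      rateKernel_univ hM hlam.le hp hσ hε hα hPb hPu hz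
  · exact (ae_restrict_iff' measurableSet_Ioi).2 (ae_of_all _ fun z hz =>
      boundIntegrand_nonneg hlam.le hp hσ hε hPb.le hPu hz)

lemma lintegral_rateKernel_le {M : ℕ} (hM : 1 ≤ M) {lam p σ ε α Pb Pu : ℝ} (hlam : 0 < lam)
    (hp : 0 ≤ p) (hσ : 0 ≤ σ) (hε : 0 ≤ ε) (hα : 2 < α) (hPb : 0 < Pb) (hPu : 0 ≤ Pu)
    (D A : Set Plane) :
    ∫⁻ z in Set.Ioi (0 : ℝ), rateKernel M lam p σ D ε α Pb Pu A z ≤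
      ENNReal.ofReal (rateBound M lam p σ ε α Pb Pu) := by
  rw [← lintegral_rateKernel_univ hM hlam hp hσ hε hα hPb hPu]
  exact lintegral_mono fun _ => rateKernel_mono D A

lemma rateBound_nonneg {M : ℕ} {lam p σ ε α Pb Pu : ℝ} (hlam : 0 ≤ lam) (hp : 0 ≤ p)
    (hσ : 0 ≤ σ) (hε : 0 ≤ ε) (hPb : 0 ≤ Pb) (hPu : 0 ≤ Pu) :
    0 ≤ rateBound M lam p σ ε α Pb Pu :=
  setIntegral_nonneg measurableSet_Ioi fun _ hz =>
    boundIntegrand_nonneg hlam hp hσ hε hPb hPu hz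

/-! ### Mellin transforms and the Meijer function -/

/-- The Mellin transform of the multiplicative convolution `x ↦ ∫ w(u) g(x u) du`. -/
lemma hasMellin_integral {w g : ℝ → ℂ} (hw : Measurable w) (hg : Measurable g) {s : ℂ}
    (hgs : MellinConvergent g s)
    (hws : IntegrableOn (fun u : ℝ => (u : ℂ) ^ (-s) * w u) (Set.Ioi 0)) :
    HasMellin (fun x => ∫ u in Set.Ioi (0 : ℝ), w u * g (x * u)) s
      ((∫ u in Set.Ioi (0 : ℝ), (u : ℂ) ^ (-s) * w u) * mellin g s) := by
  set μ := (volume : Measure ℝ).restrict (Set.Ioi 0)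
  set F : ℝ × ℝ → ℂ := fun q => (q.1 : ℂ) ^ (s - 1) * (w q.2 * g (q.1 * q.2)) with hF
  have hFm : Measurable F := by fun_prop
  set C := ∫ y in Set.Ioi (0 : ℝ), ‖(y : ℂ) ^ (s - 1) * g y‖
  have hint : Integrable F (μ.prod μ) := by
    rw [integrable_prod_iff' hFm.aestronglyMeasurable]
    constructor
    · refine (ae_restrict_iff' measurableSet_Ioi).2 (ae_of_all _ fun u hu => ?_)
      have h1 : MellinConvergent (fun x => g (x * u)) s :=
        by simpa only [mul_comm] using (MellinConvergent.comp_mul_left hu).2 hgs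
      refine (Integrable.const_mul h1 (w u)).congr (ae_of_all _ fun x => ?_)
      simp only [hF, smul_eq_mul]
      ring
    · refine (hws.norm.mul_const C).congr ((ae_restrict_iff' measurableSet_Ioi).2
        (ae_of_all _ fun u hu => ?_))
      have hu : 0 < u := hu
      -- Substituting y = xu makes the x-integral of the norm equal to C u^{-Re s} ‖w u‖, which
      -- `hws` makes integrable.
      have h2 : ∀ x ∈ Set.Ioi (0 : ℝ), ‖F (x, u)‖ = ‖w u‖ * u ^ (1 - s.re) *
          (fun y : ℝ => ‖(y : ℂ) ^ (s - 1) * g y‖) (x * u) := by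
        intro x hx
        have hx : 0 < x := hx
        simp only [hF, norm_mul]
        rw [Complex.norm_cpow_eq_rpow_re_of_pos hx,
          Complex.norm_cpow_eq_rpow_re_of_pos (mul_pos hx hu), Real.mul_rpow hx.le hu.le]
        have h3 : u ^ (1 - s.re) * u ^ (s - 1).re = 1 := by
          rw [← Real.rpow_add hu]
          simp
        linear_combination (-(x ^ (s - 1).re * ‖w u‖ * ‖g (x * u)‖)) * h3
      have h5 : ∫ x, ‖F (x, u)‖ ∂μ = _ := setIntegral_congr_fun measurableSet_Ioi h2
      have h6 := integral_comp_mul_right_Ioi (fun y : ℝ => ‖(y : ℂ) ^ (s - 1) * g y‖) 0 hu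
      rw [zero_mul] at h6
      simp only [h5]
      rw [integral_const_mul, h6, norm_mul,
        Complex.norm_cpow_eq_rpow_re_of_pos hu, smul_eq_mul, Real.rpow_sub hu, Real.rpow_one,
        Complex.neg_re, Real.rpow_neg hu.le]
      field_simp
      rfl
  have hpt : ∀ x : ℝ, (x : ℂ) ^ (s - 1) • ∫ u in Set.Ioi (0 : ℝ), w u * g (x * u) =
      ∫ u, F (x, u) ∂μ := fun x => by
    rw [smul_eq_mul, ← integral_const_mul]
  refine ⟨?_, ?_⟩
  · refine (hint.integral_prod_left).congr (ae_of_all _ fun x => ?_)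
    exact (hpt x).symm
  · rw [mellin]
    rw [integral_congr_ae (ae_of_all _ hpt)]
    rw [integral_integral_swap (f := fun x u => F (x, u)) hint, ← integral_mul_const]
    refine setIntegral_congr_fun measurableSet_Ioi fun u hu => ?_
    have hu : 0 < u := hu
    have h4 := mellin_comp_mul_right g s hu
    rw [smul_eq_mul, mellin] at h4
    simp only [hF]
    rw [mul_right_comm, ← h4, mul_comm, ← integral_const_mul]
    refine integral_congr_ae (ae_of_all _ fun x => ?_)
    simp only [smul_eq_mul]
    ring

lemma hasMellin_exp_neg {s : ℂ} (hs : 0 < s.re) :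
    HasMellin (fun x : ℝ => (Real.exp (-x) : ℂ)) s (Complex.Gamma s) := by
  refine ⟨?_, ?_⟩
  · refine (Complex.GammaIntegral_convergent hs).congr (ae_of_all _ fun x => ?_)
    simp only [smul_eq_mul]
    rw [mul_comm]
  · rw [Complex.Gamma_eq_integral hs, Complex.GammaIntegral_eq_mellin]

lemma integral_cpow_neg_mul {a : ℝ} {s : ℂ} (hs : s.re < a) :
    IntegrableOn (fun u : ℝ => (u : ℂ) ^ (-s) * ((u ^ (a - 1) * Real.exp (-u) : ℝ) : ℂ))
        (Set.Ioi 0) ∧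
      ∫ u in Set.Ioi (0 : ℝ), (u : ℂ) ^ (-s) * ((u ^ (a - 1) * Real.exp (-u) : ℝ) : ℂ) =
        Complex.Gamma (a - s) := by
  have hs' : 0 < ((a : ℂ) - s).re := by simpa using hs
  have h := hasMellin_exp_neg hs'
  have h1 : ∀ u ∈ Set.Ioi (0 : ℝ), (u : ℂ) ^ ((a : ℂ) - s - 1) • (Real.exp (-u) : ℂ) =
      (u : ℂ) ^ (-s) * ((u ^ (a - 1) * Real.exp (-u) : ℝ) : ℂ) := by
    intro u hu
    have hu : 0 < u := hu
    rw [smul_eq_mul, show (a : ℂ) - s - 1 = -s + (a - 1 : ℝ) by push_cast; ring,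
      Complex.cpow_add _ _ (by exact_mod_cast hu.ne'), Complex.ofReal_mul,
      Complex.ofReal_cpow hu.le]
    ring
  refine ⟨IntegrableOn.congr_fun h.1 h1 measurableSet_Ioi, ?_⟩
  rw [← h.2, mellin, setIntegral_congr_fun measurableSet_Ioi h1]

lemma hasMellin_inv_one_add {s : ℂ} (hs0 : 0 < s.re) (hs1 : s.re < 1) :
    HasMellin (fun x : ℝ => (((1 + x)⁻¹ : ℝ) : ℂ)) s (Complex.Gamma (1 - s) * Complex.Gamma s) := by
  have hm := hasMellin_exp_neg hs0
  have hw := integral_cpow_neg_mul (a := 1) hs1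
  -- 1/(1+x) = ∫ e^{-u} e^{-xu} du is a convolution of two exponentials; the trivial power of u
  -- matches `integral_cpow_neg_mul` at a = 1.
  have h := hasMellin_integral (w := fun u => ((u ^ ((1 : ℝ) - 1) * Real.exp (-u) : ℝ) : ℂ))
    (by fun_prop) (by fun_prop) hm.1 hw.1
  have h1 : ∀ x ∈ Set.Ioi (0 : ℝ), ∫ u in Set.Ioi (0 : ℝ),
      ((u ^ ((1 : ℝ) - 1) * Real.exp (-u) : ℝ) : ℂ) * (Real.exp (-(x * u)) : ℂ) =
      (((1 + x)⁻¹ : ℝ) : ℂ) := by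
    intro x hx
    have hx : 0 < x := hx
    simp_rw [← Complex.ofReal_mul]
    rw [integral_complex_ofReal]
    congr 1
    have h2 := Real.integral_rpow_mul_exp_neg_mul_Ioi one_pos (show 0 < 1 + x by positivity)
    rw [Real.rpow_one, Real.Gamma_one, mul_one, one_div] at h2
    rw [← h2]
    refine integral_congr_ae (ae_of_all _ fun u => ?_)
    simp only
    rw [mul_assoc, ← Real.exp_add]
    ring_nf
  have h3 : ∀ x ∈ Set.Ioi (0 : ℝ), (x : ℂ) ^ (s - 1) • (∫ u in Set.Ioi (0 : ℝ),
      ((u ^ ((1 : ℝ) - 1) * Real.exp (-u) : ℝ) : ℂ) * (Real.exp (-(x * u)) : ℂ)) =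
      (x : ℂ) ^ (s - 1) • (((1 + x)⁻¹ : ℝ) : ℂ) := fun x hx => by rw [h1 x hx]
  refine ⟨IntegrableOn.congr_fun h.1 h3 measurableSet_Ioi, ?_⟩
  have h4 := h.2
  rw [mellin, setIntegral_congr_fun measurableSet_Ioi h3, hw.2, hm.2, Complex.ofReal_one] at h4
  exact h4

/-- `∫ u^{a - 1} e^{-u} / (1 + x u) du`. -/
noncomputable def stieltjesGamma (a x : ℝ) : ℝ :=
  ∫ u in Set.Ioi (0 : ℝ), u ^ (a - 1) * Real.exp (-u) * (1 + x * u)⁻¹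

lemma ofReal_stieltjesGamma (a x : ℝ) : (stieltjesGamma a x : ℂ) = ∫ u in Set.Ioi (0 : ℝ),
    ((u ^ (a - 1) * Real.exp (-u) : ℝ) : ℂ) * (((1 + x * u)⁻¹ : ℝ) : ℂ) := by
  simp_rw [← Complex.ofReal_mul]
  rw [integral_complex_ofReal, stieltjesGamma]

/-- A second convolution, of 1/(1+x) with a Gamma weight, adds the factor Γ(a-s). -/
lemma hasMellin_stieltjesGamma {a : ℝ} {s : ℂ} (hs0 : 0 < s.re) (hs1 : s.re < 1) (hsa : s.re < a) :
    HasMellin (fun x => (stieltjesGamma a x : ℂ)) s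
      (Complex.Gamma (a - s) * (Complex.Gamma (1 - s) * Complex.Gamma s)) := by
  have hm := hasMellin_inv_one_add hs0 hs1
  have hw := integral_cpow_neg_mul hsa
  have h := hasMellin_integral (w := fun u => ((u ^ (a - 1) * Real.exp (-u) : ℝ) : ℂ))
    (by fun_prop) (by fun_prop) hm.1 hw.1
  rw [hm.2, hw.2] at h
  simp_rw [ofReal_stieltjesGamma]
  exact h

lemma continuousAt_stieltjesGamma {a x : ℝ} (ha : 0 < a) (hx : 0 < x) :
    ContinuousAt (stieltjesGamma a) x := by
  refine continuousAt_of_dominated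
    (bound := fun u => u ^ (a - 1) * Real.exp (-(1 * u))) (Eventually.of_forall fun y => ?_) ?_
    (integrableOn_rpow_mul_exp_neg_mul ha one_pos) ?_
  · exact Measurable.aestronglyMeasurable (by fun_prop)
  · filter_upwards [lt_mem_nhds hx] with y hy
    refine (ae_restrict_iff' measurableSet_Ioi).2 (ae_of_all _ fun u hu => ?_)
    have hu : 0 < u := hu
    rw [Real.norm_of_nonneg (by positivity), one_mul]
    refine mul_le_of_le_one_right (by positivity) (inv_le_one_of_one_le₀ ?_)
    have : 0 < y * u := by positivity
    linarith
  · refine (ae_restrict_iff' measurableSet_Ioi).2 (ae_of_all _ fun u hu => ?_)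
    have hu : 0 < u := hu
    have : 1 + x * u ≠ 0 := by positivity
    exact continuousAt_const.mul ((by fun_prop : ContinuousAt (fun x => 1 + x * u) x).inv₀ this)

lemma norm_Gamma_le {s : ℂ} (hs : 0 < s.re) : ‖Complex.Gamma s‖ ≤ Real.Gamma s.re := by
  rw [Complex.Gamma_eq_integral hs, Complex.GammaIntegral, Real.Gamma_eq_integral hs]
  refine (norm_integral_le_integral_norm _).trans_eq ?_
  refine setIntegral_congr_fun measurableSet_Ioi fun x hx => ?_
  simp only [norm_mul]
  rw [Complex.norm_cpow_eq_rpow_re_of_pos hx, Complex.norm_real,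
    Real.norm_of_nonneg (Real.exp_pos _).le]
  simp

/-- Quadratic growth is enough, since its reciprocal is integrable. It follows from e^y ≥ 1 + y +
y²/2 and π² ≥ 9. -/
lemma cosh_pi_mul_ge (t : ℝ) : (1 + t ^ 2) / 2 ≤ Real.cosh (Real.pi * t) := by
  rw [← Real.cosh_abs, Real.cosh_eq]
  have h1 := Real.quadratic_le_exp_of_nonneg (abs_nonneg (Real.pi * t))
  have h2 := Real.exp_pos (-|Real.pi * t|)
  have h3 := abs_nonneg (Real.pi * t)
  rw [sq_abs, mul_pow] at h1
  have h4 : 3 * 3 ≤ Real.pi ^ 2 := by nlinarith [Real.pi_gt_three]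
  nlinarith [sq_nonneg t]

lemma norm_sin_pi_mul_ge {c : ℝ} (hc0 : 0 < c) (hc1 : c < 1) (t : ℝ) :
    Real.sin (Real.pi * c) * ((1 + t ^ 2) / 2) ≤ ‖Complex.sin (Real.pi * (c + t * Complex.I))‖ := by
  have hsin : 0 < Real.sin (Real.pi * c) :=
    Real.sin_pos_of_pos_of_lt_pi (by have := Real.pi_pos; positivity)
      (by nlinarith [Real.pi_pos])
  have hre : (Complex.sin (Real.pi * (c + t * Complex.I))).re =
      Real.sin (Real.pi * c) * Real.cosh (Real.pi * t) := by
    have : (Real.pi : ℂ) * (c + t * Complex.I) =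
        ((Real.pi * c : ℝ) : ℂ) + ((Real.pi * t : ℝ) : ℂ) * Complex.I := by push_cast; ring
    rw [this, Complex.sin_add_mul_I, ← Complex.ofReal_sin, ← Complex.ofReal_cosh,
      ← Complex.ofReal_cos, ← Complex.ofReal_sinh, ← Complex.ofReal_mul, ← Complex.ofReal_mul,
      Complex.add_re, Complex.re_ofReal_mul, Complex.ofReal_re, Complex.I_re, mul_zero, add_zero]
  calc _ ≤ Real.sin (Real.pi * c) * Real.cosh (Real.pi * t) :=
        mul_le_mul_of_nonneg_left (cosh_pi_mul_ge t) hsin.le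
    _ ≤ _ := by rw [← hre]; exact Complex.re_le_norm _

/-- By reflection Γ(1-s)Γ(s) = π / sin(πs), which is O(1/(1+t²)) on the line, while Γ(a-s) is
bounded by Γ(a-c). -/
lemma verticalIntegrable_stieltjesGamma {a c : ℝ} (hc0 : 0 < c) (hc1 : c < 1) (hca : c < a) :
    Complex.VerticalIntegrable (mellin fun x => (stieltjesGamma a x : ℂ)) c := by
  have hval : ∀ t : ℝ, mellin (fun x => (stieltjesGamma a x : ℂ)) (c + t * Complex.I) =
      Complex.Gamma (a - (c + t * Complex.I)) *
        (Complex.Gamma (1 - (c + t * Complex.I)) * Complex.Gamma (c + t * Complex.I)) := fun t =>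
    (hasMellin_stieltjesGamma (by simpa using hc0) (by simpa using hc1) (by simpa using hca)).2
  have hG : ∀ f : ℝ → ℂ, Continuous f → (∀ t, 0 < (f t).re) →
      Continuous fun t => Complex.Gamma (f t) := by
    intro f hf hpos
    refine continuous_iff_continuousAt.2 fun t => ContinuousAt.comp
      (Complex.differentiableAt_Gamma _ fun m hm => ?_).continuousAt hf.continuousAt
    have := hpos t
    rw [hm] at this
    simp only [Complex.neg_re, Complex.natCast_re] at this
    have : (0 : ℝ) ≤ m := m.cast_nonneg
    linarith
  unfold Complex.VerticalIntegrable
  simp_rw [hval]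
  have hsin : 0 < Real.sin (Real.pi * c) :=
    Real.sin_pos_of_pos_of_lt_pi (by have := Real.pi_pos; positivity) (by nlinarith [Real.pi_pos])
  have hpi := Real.pi_pos
  refine (integrable_inv_one_add_sq.const_mul
    (Real.Gamma (a - c) * (2 * Real.pi / Real.sin (Real.pi * c)))).mono'
    (Continuous.aestronglyMeasurable ?_) (ae_of_all _ fun t => ?_)
  · exact (hG _ (by fun_prop) fun t => by simpa using hca).mul
      ((hG _ (by fun_prop) fun t => by simpa using hc1).mul
        (hG _ (by fun_prop) fun t => by simpa using hc0))
  · rw [norm_mul, mul_comm (Complex.Gamma (1 - _)), Complex.Gamma_mul_Gamma_one_sub, norm_div,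
      mul_assoc]
    have hre : ((a : ℂ) - (c + t * Complex.I)).re = a - c := by simp
    have h1 : ‖Complex.Gamma (a - (c + t * Complex.I))‖ ≤ Real.Gamma (a - c) := by
      have := norm_Gamma_le (s := (a : ℂ) - (c + t * Complex.I)) (by rw [hre]; linarith)
      rwa [hre] at this
    have h2 := norm_sin_pi_mul_ge hc0 hc1 t
    have h3 : ‖(Real.pi : ℂ)‖ = Real.pi := by
      rw [Complex.norm_real, Real.norm_of_nonneg hpi.le]
    rw [h3]
    refine mul_le_mul h1 ?_ (by positivity) (Real.Gamma_pos_of_pos (by linarith)).le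
    calc _ ≤ Real.pi / (Real.sin (Real.pi * c) * ((1 + t ^ 2) / 2)) :=
          div_le_div_of_nonneg_left hpi.le (by positivity) h2
      _ = _ := by field_simp

/-- The Meijer function `G_{2 1}^{1 2} (x | 1 - a, 0 ; 0)` as a Stieltjes transform. -/
theorem meijerG_eq {a x : ℝ} (ha : 0 < a) (hx : 0 < x) :
    meijerG 1 2 ![1 - (a : ℂ), 0] ![0] (x : ℂ) = stieltjesGamma a x := by
  have hex : ∃ γ : ℝ, MeijerSeparates 1 2 ![1 - (a : ℂ), 0] ![0] γ := by
    -- The midpoint of the strip max(-a, -1) < γ < 0 that separates the poles.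
    refine ⟨-(min a 1) / 2, ?_, ?_⟩
    · have h3 : 0 < min a 1 := lt_min ha one_pos
      intro j _
      fin_cases j
      simp only [Fin.zero_eta, Matrix.cons_val_zero, Complex.zero_re]
      linarith
    · have h1 := min_le_left a 1
      have h2 := min_le_right a 1
      have h3 : 0 < min a 1 := lt_min ha one_pos
      intro j _
      fin_cases j
      · simp; linarith
      · simp; linarith
  rw [meijerG, dif_pos hex]
  -- Nothing is known of the chosen γ beyond separation, which is all that Mellin inversion on the
  -- line Re s = -γ requires.
  have hsep := hex.choose_spec
  set γ := hex.choose
  have hγ0 : γ < 0 := by simpa using hsep.1 0 (by simp)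
  have hγa : -a < γ := by simpa using hsep.2 0 (by simp)
  have hγ1 : -1 < γ := by simpa using hsep.2 1 (by simp)
  have hc0 : 0 < -γ := by linarith
  have hc1 : -γ < 1 := by linarith
  have hca : -γ < a := by linarith
  have hinv := mellinInv_mellin_eq (-γ) (fun x => (stieltjesGamma a x : ℂ)) hx
    (hasMellin_stieltjesGamma (s := ((-γ : ℝ) : ℂ)) (by simpa using hc0) (by simpa using hc1)
      (by simpa using hca)).1
    (verticalIntegrable_stieltjesGamma hc0 hc1 hca)
    (Complex.continuous_ofReal.continuousAt.comp (continuousAt_stieltjesGamma ha hx))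
  -- Mellin inversion carries x^{-s} and the Mellin-Barnes integral x^s; the change t ↦ -t, hence s
  -- ↦ -s, matches them.
  rw [← hinv, mellinInv, ← integral_neg_eq_self, Complex.real_smul]
  congr 1
  · push_cast; rfl
  refine integral_congr_ae (ae_of_all _ fun t => ?_)
  have hM := (hasMellin_stieltjesGamma (a := a) (s := ((-γ : ℝ) : ℂ) + (t : ℂ) * Complex.I)
    (by simpa using hc0) (by simpa using hc1) (by simpa using hca)).2
  have hs : ((-γ : ℝ) : ℂ) + (t : ℂ) * Complex.I = -((γ : ℂ) + ((-t : ℝ) : ℂ) * Complex.I) := by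
    push_cast; ring
  rw [hs] at hM
  simp only [smul_eq_mul]
  rw [hs, hM, meijerIntegrand]
  generalize (γ : ℂ) + ((-t : ℝ) : ℂ) * Complex.I = s
  simp [Fin.prod_univ_two]
  ring

/-! ### The series for the singular path loss -/

/-- As δ < 1, the growth of e^{b z^δ} costs at most half of the decay e^{-z}. Beyond K one has b z^δ
≤ z/2; below it the constant b K^δ suffices. -/
lemma mul_rpow_le_half_add {b δ : ℝ} (hb : 0 < b) (hδ0 : 0 < δ) (hδ1 : δ < 1) :
    ∃ C : ℝ, ∀ z : ℝ, 0 < z → b * z ^ δ ≤ z / 2 + C := by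
  set K := (2 * b) ^ (1 / (1 - δ)) with hK
  have hK0 : 0 < K := by positivity
  refine ⟨b * K ^ δ, fun z hz => ?_⟩
  rcases le_total z K with h | h
  · have := Real.rpow_le_rpow hz.le h hδ0.le
    nlinarith
  · have h1 : 2 * b ≤ z ^ (1 - δ) := by
      have h2 := Real.rpow_le_rpow hK0.le h (sub_pos.2 hδ1).le
      rwa [hK, ← Real.rpow_mul (by positivity), one_div_mul_cancel (sub_pos.2 hδ1).ne',
        Real.rpow_one] at h2
    have h3 : z ^ (1 - δ) * z ^ δ = z := by
      rw [← Real.rpow_add hz]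
      simp
    have h4 : 0 < z ^ δ := by positivity
    have h5 : 0 ≤ b * K ^ δ := by positivity
    nlinarith

/-- The bound for the series of absolute values: e^y - 1 ≤ y e^y provides the factor z^δ at the
origin, and `mul_rpow_le_half_add` controls infinity. -/
lemma integrableOn_exp_sub_one {b δ x : ℝ} (hb : 0 ≤ b) (hδ0 : 0 < δ) (hδ1 : δ < 1) (hx : 0 < x) :
    IntegrableOn (fun z : ℝ => (Real.exp (b * z ^ δ) - 1) * (Real.exp (-z) / (z * (1 + x * z))))
      (Set.Ioi 0) := by
  rcases hb.eq_or_lt with rfl | hb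
  · simp
  obtain ⟨C, hC⟩ := mul_rpow_le_half_add hb hδ0 hδ1
  refine ((integrableOn_rpow_mul_exp_neg_mul hδ0 (one_half_pos (α := ℝ))).const_mul
    (b * Real.exp C)).mono' (by fun_prop)
    ((ae_restrict_iff' measurableSet_Ioi).2 (ae_of_all _ fun z hz => ?_))
  have hz : 0 < z := hz
  set y := b * z ^ δ with hy
  have hy0 : 0 < y := by positivity
  have h1 : Real.exp y - 1 ≤ y * Real.exp y := by
    have h := Real.add_one_le_exp (-y)
    have h2 : Real.exp (-y) * Real.exp y = 1 := by rw [← Real.exp_add]; simp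
    nlinarith [Real.exp_pos y]
  have h0 : 0 ≤ Real.exp y - 1 := by linarith [Real.one_le_exp hy0.le]
  have h2 : Real.exp (-z) / (z * (1 + x * z)) ≤ Real.exp (-z) / z := by
    refine div_le_div_of_nonneg_left (Real.exp_pos _).le hz (le_mul_of_one_le_right hz.le ?_)
    have : 0 ≤ x * z := by positivity
    linarith
  have h3 : Real.exp y ≤ Real.exp (z / 2) * Real.exp C := by
    rw [← Real.exp_add]; exact Real.exp_le_exp.2 (hC z hz)
  rw [Real.norm_of_nonneg (mul_nonneg h0 (by positivity))]
  calc _ ≤ y * (Real.exp (z / 2) * Real.exp C) * (Real.exp (-z) / z) :=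
        mul_le_mul (h1.trans (mul_le_mul_of_nonneg_left h3 hy0.le)) h2 (by positivity)
          (by positivity)
    _ = b * Real.exp C * (z ^ (δ - 1) * Real.exp (-(1 / 2 * z))) := by
      have h4 : Real.exp (-(1 / 2 * z)) = Real.exp (z / 2) * Real.exp (-z) := by
        rw [← Real.exp_add]; congr 1; ring
      rw [h4, Real.rpow_sub_one hz.ne', hy]
      ring

lemma hasSum_exp_sub_one (y : ℝ) :
    HasSum (fun k : ℕ => y ^ (k + 1) / (k + 1).factorial) (Real.exp y - 1) := by
  have h := NormedSpace.expSeries_div_hasSum_exp (𝔸 := ℝ) y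
  rw [← Real.exp_eq_exp_ℝ, ← hasSum_nat_add_iff' 1] at h
  simpa using h

/-- Termwise integration of the exponential series, dominated by the series with |c|. The index
starts at k + 1 because the constant term cancels against 1. -/
lemma hasSum_stieltjesGamma {c δ x : ℝ} (hδ0 : 0 < δ) (hδ1 : δ < 1) (hx : 0 < x) :
    HasSum (fun k : ℕ => -(c ^ (k + 1) / (k + 1).factorial * stieltjesGamma (δ * (k + 1)) x))
      (∫ z in Set.Ioi (0 : ℝ), (1 - Real.exp (c * z ^ δ)) * (Real.exp (-z) / (z * (1 + x * z)))) := by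
  set F : ℕ → ℝ → ℝ := fun k z =>
    -((c * z ^ δ) ^ (k + 1) / (k + 1).factorial * (Real.exp (-z) / (z * (1 + x * z)))) with hF
  have hFi : ∀ k, ∫ z in Set.Ioi (0 : ℝ), F k z =
      -(c ^ (k + 1) / (k + 1).factorial * stieltjesGamma (δ * (k + 1)) x) := by
    intro k
    rw [stieltjesGamma, ← integral_const_mul, ← integral_neg]
    refine setIntegral_congr_fun measurableSet_Ioi fun z hz => ?_
    have hz : 0 < z := hz
    have h1 : (z ^ δ) ^ (k + 1) = z ^ (δ * (k + 1)) := by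
      rw [← Real.rpow_natCast, ← Real.rpow_mul hz.le]
      push_cast
      rfl
    simp only [hF]
    rw [mul_pow, h1, Real.rpow_sub_one hz.ne']
    field_simp
  simp_rw [← hFi]
  set bd : ℕ → ℝ → ℝ := fun k z =>
    (|c| * z ^ δ) ^ (k + 1) / (k + 1).factorial * (Real.exp (-z) / (z * (1 + x * z))) with hbd
  have hbs : ∀ z, HasSum (fun k => bd k z)
      ((Real.exp (|c| * z ^ δ) - 1) * (Real.exp (-z) / (z * (1 + x * z)))) := fun z =>
    (hasSum_exp_sub_one _).mul_right _
  refine hasSum_integral_of_dominated_convergence bd (fun k => ?_) (fun k => ?_)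
    (ae_of_all _ fun z => (hbs z).summable) ?_ (ae_of_all _ fun z => ?_)
  · exact Measurable.aestronglyMeasurable (by fun_prop)
  · refine (ae_restrict_iff' measurableSet_Ioi).2 (ae_of_all _ fun z hz => ?_)
    have hz : 0 < z := hz
    have h1 : 0 ≤ Real.exp (-z) / (z * (1 + x * z)) := by positivity
    have h2 : 0 ≤ z ^ δ := by positivity
    simp only [hF, hbd]
    rw [norm_neg, norm_mul, Real.norm_of_nonneg h1, norm_div, norm_pow, norm_mul,
      Real.norm_eq_abs c, Real.norm_of_nonneg h2, RCLike.norm_natCast]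
  · simp_rw [fun z => (hbs z).tsum_eq]
    exact integrableOn_exp_sub_one (abs_nonneg c) hδ0 hδ1 hx
  · have := ((hasSum_exp_sub_one (c * z ^ δ)).mul_right
      (Real.exp (-z) / (z * (1 + x * z)))).neg
    convert! this using 1
    ring

/-- `HasSum` in ℂ is unconditional, hence absolute, convergence. -/
theorem hasSum_seriesTerm {M : ℕ} (hM : 1 ≤ M) (lam p : ℝ) {σ α Pb Pu : ℝ} (hσ : 0 < σ)
    (hα : 2 < α) (hPb : 0 < Pb) (hPu : 0 < Pu) :
    HasSum (fun k : ℕ => seriesTerm M lam p σ (2 / α) Pb Pu (k + 1))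
      (rateBound M lam p σ 0 α Pb Pu : ℂ) := by
  have hδ0 : 0 < 2 / α := by positivity
  have hδ1 : 2 / α < 1 := by rw [div_lt_one (by linarith)]; exact hα
  set δ := 2 / α with hδ
  have hx : 0 < Pu * σ := by positivity
  have h1 : rateBound M lam p σ 0 α Pb Pu = ∫ z in Set.Ioi (0 : ℝ),
      (1 - Real.exp (gammaConst M lam p δ * Pb ^ δ * z ^ δ)) *
        (Real.exp (-z) / (z * (1 + Pu * σ * z))) :=
    setIntegral_congr_fun measurableSet_Ioi fun z hz =>
      boundIntegrand_zero_eq hM lam p σ Pu hα hPb hz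
  have h2 := Complex.hasSum_ofReal.2
    (hasSum_stieltjesGamma (c := gammaConst M lam p δ * Pb ^ δ) hδ0 hδ1 hx)
  rw [← h1] at h2
  convert! h2 using 2 with k
  have hk : 0 < δ * ((k : ℝ) + 1) := by positivity
  have h3 := meijerG_eq hk hx
  rw [seriesTerm, Real.Gamma_nat_eq_factorial]
  push_cast at h3 ⊢
  rw [h3]

end CRAN

theorem proposition2 {Ω : Type*} [MeasurableSpace Ω] (P : Measure Ω) [IsProbabilityMeasure P]
    (M : ℕ) (hM : 1 ≤ M) (lam p σ α Pb Pu : ℝ) (hlam : 0 < lam) (hp : p ∈ Set.Icc (0 : ℝ) 1)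
    (hσ : 0 < σ) (hα : 2 < α) (hPb : 0 < Pb) (hPu : 0 < Pu)
    (D : Set CRAN.Plane) (hD : MeasurableSet D) (S : CRAN.Network P M lam p σ D) :
    -- non-singular and singular path loss: the bound, and its attainment as the radius tends to `∞`
    (∀ ε : ℝ, 0 ≤ ε →
      (∀ z : ℝ, 0 < z →
        IntegrableOn (CRAN.exponentIntegrand M ε α Pb z) (Set.Ioi 0)) ∧
      IntegrableOn (CRAN.boundIntegrand M lam p σ ε α Pb Pu) (Set.Ioi 0) ∧
      (∀ R : ℝ, 0 < R →
        Integrable (fun ω => Real.log (1 + S.sinr ε α Pb Pu (Metric.ball 0 R) ω)) P ∧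
        S.avgRate ε α Pb Pu (Metric.ball 0 R) ≤ CRAN.rateBound M lam p σ ε α Pb Pu) ∧
      (D = Set.univ →
        (∀ᵐ ω ∂P, Summable (fun k => S.receivedPower ε α Pb Set.univ k ω)) ∧
        Integrable (fun ω => Real.log (1 + S.sinr ε α Pb Pu Set.univ ω)) P ∧
        S.avgRate ε α Pb Pu Set.univ = CRAN.rateBound M lam p σ ε α Pb Pu ∧
        Tendsto (fun R : ℝ => S.avgRate ε α Pb Pu (Metric.ball 0 R)) atTop
          (𝓝 (CRAN.rateBound M lam p σ ε α Pb Pu)))) ∧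
    -- singular path loss: the closed form of the bound
    (∃ Rbar : ℝ,
      HasSum (fun k : ℕ => CRAN.seriesTerm M lam p σ (2 / α) Pb Pu (k + 1)) (Rbar : ℂ) ∧
      Tendsto (fun ε : ℝ => CRAN.rateBound M lam p σ ε α Pb Pu) (𝓝[>] 0) (𝓝 Rbar) ∧
      CRAN.rateBound M lam p σ 0 α Pb Pu = Rbar ∧
      (∀ R : ℝ, 0 < R → S.avgRate 0 α Pb Pu (Metric.ball 0 R) ≤ Rbar) ∧
      (D = Set.univ →
        Tendsto (fun R : ℝ => S.avgRate 0 α Pb Pu (Metric.ball 0 R)) atTop (𝓝 Rbar))) := by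
  have hball : ∀ R : ℝ, MeasurableSet (Metric.ball (0 : CRAN.Plane) R) := fun R =>
    Metric.isOpen_ball.measurableSet
  -- This one comparison yields both the finiteness needed for the rate formula and the bound
  -- itself.
  have hle : ∀ ε : ℝ, 0 ≤ ε → ∀ A : Set CRAN.Plane,
      ∫⁻ z in Set.Ioi (0 : ℝ), CRAN.rateKernel M lam p σ D ε α Pb Pu A z ≤
        ENNReal.ofReal (CRAN.rateBound M lam p σ ε α Pb Pu) := fun ε hε A =>
    CRAN.lintegral_rateKernel_le hM hlam hp.1 hσ.le hε hα hPb hPu.le D A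
  have hfin : ∀ ε : ℝ, 0 ≤ ε → ∀ A : Set CRAN.Plane,
      ∫⁻ z in Set.Ioi (0 : ℝ), CRAN.rateKernel M lam p σ D ε α Pb Pu A z ≠ ∞ := fun ε hε A =>
    ((hle ε hε A).trans_lt ENNReal.ofReal_lt_top).ne
  have hbound : ∀ ε : ℝ, 0 ≤ ε → ∀ R : ℝ, S.avgRate ε α Pb Pu (Metric.ball 0 R) ≤
      CRAN.rateBound M lam p σ ε α Pb Pu := by
    intro ε hε R
    rw [S.avgRate_eq hlam hp hσ hε hPb.le hPu.le (hball R) (hfin ε hε _)]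
    exact ENNReal.toReal_le_of_le_ofReal
      (CRAN.rateBound_nonneg hlam.le hp.1 hσ.le hε hPb.le hPu.le) (hle ε hε _)
  have hplane : ∀ ε : ℝ, 0 ≤ ε → D = Set.univ →
      (∀ᵐ ω ∂P, Summable (fun k => S.receivedPower ε α Pb Set.univ k ω)) ∧
      Integrable (fun ω => Real.log (1 + S.sinr ε α Pb Pu Set.univ ω)) P ∧
      S.avgRate ε α Pb Pu Set.univ = CRAN.rateBound M lam p σ ε α Pb Pu ∧
      Tendsto (fun R : ℝ => S.avgRate ε α Pb Pu (Metric.ball 0 R)) atTop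
        (𝓝 (CRAN.rateBound M lam p σ ε α Pb Pu)) := by
    intro ε hε hDu
    have hX := S.totalPower_ne_top hlam hp hσ hε hPb.le hPu.le MeasurableSet.univ (hfin ε hε _)
    have hint := S.integrable_log_sinr hlam hp hσ hε hPb.le hPu.le MeasurableSet.univ (hfin ε hε _)
    have heq : S.avgRate ε α Pb Pu Set.univ = CRAN.rateBound M lam p σ ε α Pb Pu := by
      rw [S.avgRate_eq hlam hp hσ hε hPb.le hPu.le MeasurableSet.univ (hfin ε hε _), hDu,
        CRAN.lintegral_rateKernel_univ hM hlam hp.1 hσ.le hε hα hPb hPu.le, ENNReal.toReal_ofReal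
        (CRAN.rateBound_nonneg hlam.le hp.1 hσ.le hε hPb.le hPu.le)]
    refine ⟨?_, hint, heq, ?_⟩
    · filter_upwards [hX] with ω hω
      exact S.summable_receivedPower hε hPb.le hω
    · rw [← heq]
      exact S.tendsto_avgRate hε hPb.le hPu.le hX hint
  -- The witness for `Rbar` is the bound at ε = 0, so the closed form is the statement about the
  -- series.
  refine ⟨fun ε hε => ⟨fun z hz => CRAN.integrableOn_exponentIntegrand hM hε hα hPb hz,
    CRAN.integrableOn_boundIntegrand hM hlam hp.1 hσ.le hε hα hPb hPu.le, fun R _ =>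
    ⟨S.integrable_log_sinr hlam hp hσ hε hPb.le hPu.le (hball R) (hfin ε hε _), hbound ε hε R⟩,
    hplane ε hε⟩, CRAN.rateBound M lam p σ 0 α Pb Pu,
    CRAN.hasSum_seriesTerm hM lam p hσ hα hPb hPu,
    CRAN.tendsto_rateBound hM hlam hp.1 hσ.le hα hPb hPu.le, rfl,
    fun R _ => hbound 0 le_rfl R, fun hDu => (hplane 0 le_rfl hDu).2.2.2⟩
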